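/- **Setting.** Let $N_0,N_1,N_2$ be dimensions, $x_1,x_2,x_3\in\mathbb R^{N_0}$, $y_1,y_2,y_3\in\mathbb R^{N_2}$, $y=(y_1,y_2,y_3)$, $\lambda>0$, $\beta_1,\beta_2>0$, $\alpha\in[0,1)$ and $\sigma(u)=\max\{u,\alpha u\}$ (applied componentwise to vectors). The variable is $z=(\theta,u)\in\mathbb R^{\bar N}$, where $\theta=(A,V,W,b,c)$ with $A\in\mathbb R^{N_1\times N_0}$, $V\in\mathbb R^{N_2\times N_1}$, $W\in\mathbb R^{N_1\times N_1}$, $b\in\mathbb R^{N_1}$, $c\in\mathbb R^{N_2}$, and $u$ consists of $w_t,s_t\in\mathbb R^{N_1}$, $v_t,r_t\in\mathbb R^{N_2}$ $(t=1,2,3)$; put $s_0=0$, $r=(r_1,r_2,r_3)$. Let $$F(z)=\tfrac16\|r-y\|^2+\lambda\big(\|A\|_F^2+\|V\|_F^2+\|W\|_F^2+\|b\|^2+\|c\|^2\big),$$ $$\mathcal F_0=\{z: w_t=Ws_{t-1}+Ax_t+b,\ s_t=\sigma(w_t),\ v_t=Vs_t+c,\ r_t=\sigma(v_t),\ t=1,2,3\},$$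 $$\Theta(z)=F(z)+\beta_1\sum_{t=1}^3\big(\|w_t-Ws_{t-1}-Ax_t-b\|_1+\|s_t-\sigma(w_t)\|_1\big)+\beta_2\sum_{t=1}^3\big(\|v_t-Vs_t-c\|_1+\|r_t-\sigma(v_t)\|_1\big).$$ (P0-RNN) is the problem $\min_{z\in\mathcal F_0}F(z)$ and (P1-RNN) is $\min_{z\in\mathbb R^{\bar N}}\Theta(z)$; $\mathcal S_0$ and $\mathcal S_1$ are their sets of global minimizers. For a real function $f$ write $f'(z;d)=\lim_{\tau\downarrow0}\frac{f(z+\tau d)-f(z)}{\tau}$ and $f^{(2)}(z;d)=\lim_{\tau\downarrow0}\frac{f(z+\tau d)-f(z)-\tau f'(z;d)}{\tau^2/2}$; for vectors, $\sigma'(v;d)$ is taken componentwise. For a set $\mathcal F$ and $z\in\mathcal F$, the tangent cone $\mathcal T_{\mathcal F}(z)$ is the set of all limits of $(z^k-z)/\tau_k$ with $z^k\in\mathcal F$, $z^k\to z$, $\tau_k\downarrow0$, and the radial cone $P_{\mathcal F}(z)$ is the set of $d$ for which there are $\tau_k\downarrow0$ with $z+\tau_kd\in\mathcal F$ for all $k$.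 A point $z\in\mathcal F$ is a *d-stationary point* of $\min_{\mathcal F}f$ if $f'(z;d)\ge0$ for all $d\in\mathcal T_{\mathcal F}(z)$; it is a *second-order d-stationary point* if moreover $f$ is twice directionally differentiable at $z$ and $f^{(2)}(z;d)\ge0$ for all $d\in P_{\mathcal F}(z)$ with $f'(z;d)=0$. Directions $d\in\mathbb R^{\bar N}$ are split into the same blocks as $z$: $D_A,D_V,D_W$ (matrices), $d_b,d_c,d_{w_t},d_{s_t},d_{v_t},d_{r_t}$, with $d_{s_0}=0$. **Statement.** 1. $\mathcal S_0$ and $\mathcal S_1$ are nonempty and compact. 2. $F$ is twice continuously differentiable, and $\Theta$ is locally Lipschitz and twice directionally differentiable everywhere. Every local minimizer $z$ of (P0-RNN) is a second-order d-stationary point of (P0-RNN), that is, $z\in\mathcal F_0$, $\nabla F(z)^\top d\ge0$ for all $d\in\mathcal T_{\mathcal F_0}(z)$, and $d^\top\nabla^2F(z)d\ge0$ for all $d\in P_{\mathcal F_0}(z)$ with $\nabla F(z)^\top d=0$. Every local minimizer $z$ of (P1-RNN) is a second-order d-stationary point of (P1-RNN), that is, $\Theta'(z;d)\ge0$ for all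 $d\in\mathbb R^{\bar N}$ and $\Theta^{(2)}(z;d)\ge0$ for all $d$ with $\Theta'(z;d)=0$. 3. For every $z\in\mathcal F_0$, the tangent cone $\mathcal T_{\mathcal F_0}(z)$ is the set of all $d\in\mathbb R^{\bar N}$ such that, for $t=1,2,3$, $$d_{v_t}=D_Vs_t+Vd_{s_t}+d_c,\quad d_{r_t}=\sigma'(v_t;d_{v_t}),\quad d_{w_t}=D_Ws_{t-1}+Wd_{s_{t-1}}+D_Ax_t+d_b,\quad d_{s_t}=\sigma'(w_t;d_{w_t}),$$ and $$P_{\mathcal F_0}(z)=\{d\in\mathcal T_{\mathcal F_0}(z): D_Vd_{s_t}=0,\ D_Wd_{s_{t-1}}=0,\ t=1,2,3\}.$$ 4. Let $\gamma_y:=\Theta(0)=\|y\|^2/6$ and $\gamma_1:=\sum_{i=0}^{2}\big(\sqrt{\gamma_y/\lambda}\big)^i$. If $$\beta_1>\gamma_1\gamma_y\sqrt{\frac{2}{3\lambda}}\quad\text{and}\quad\beta_2>\sqrt{\frac{2\gamma_y}{3}},$$ then (a) $\mathcal S_0=\mathcal S_1$; and (b) every $z$ with $\Theta(z)\le\gamma_y$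 is a d-stationary point of (P0-RNN) if and only if it is a d-stationary point of (P1-RNN). -/

import Mathlib

open Filter Topology
open scoped Matrix

section Stationarity

variable {E : Type*} [NormedAddCommGroup E] [NormedSpace ℝ E]

/-- The one-sided directional derivative of `f` at `x` along `d` exists and equals `l`. -/
def HasDirDeriv (f : E → ℝ) (x d : E) (l : ℝ) : Prop :=
  Tendsto (fun τ : ℝ => (f (x + τ • d) - f x) / τ) (𝓝[>] 0) (𝓝 l)

/-- The one-sided second-order directional derivative of `f` at `x` along `d` exists (together
with the first-order one) and equals `q`. -/
def HasDirDeriv2 (f : E → ℝ) (x d : E) (q : ℝ) : Prop :=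
  ∃ l : ℝ, HasDirDeriv f x d l ∧
    Tendsto (fun τ : ℝ => (f (x + τ • d) - f x - τ * l) / (τ ^ 2 / 2)) (𝓝[>] 0) (𝓝 q)

/-- `f` is twice directionally differentiable at `x`. -/
def TwiceDirDifferentiableAt (f : E → ℝ) (x : E) : Prop :=
  ∀ d : E, ∃ q : ℝ, HasDirDeriv2 f x d q

/-- The (Bouligand) tangent cone of `S` at `x`. -/
def bouligandCone (S : Set E) (x : E) : Set E :=
  {d | ∃ (p : ℕ → E) (τ : ℕ → ℝ), (∀ k, p k ∈ S) ∧ Tendsto p atTop (𝓝 x) ∧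
    (∀ k, 0 < τ k) ∧ Tendsto τ atTop (𝓝 0) ∧
    Tendsto (fun k => (τ k)⁻¹ • (p k - x)) atTop (𝓝 d)}

/-- The radial cone of `S` at `x`. -/
def radialCone (S : Set E) (x : E) : Set E :=
  {d | ∃ τ : ℕ → ℝ, (∀ k, 0 < τ k) ∧ Tendsto τ atTop (𝓝 0) ∧ ∀ k, x + τ k • d ∈ S}

/-- `x` is a d(irectional)-stationary point of minimizing `f` over `S`. -/
def IsDStationary (f : E → ℝ) (S : Set E) (x : E) : Prop :=
  x ∈ S ∧ ∀ d ∈ bouligandCone S x, ∃ l : ℝ, HasDirDeriv f x d l ∧ 0 ≤ l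

/-- `x` is a second-order d-stationary point of minimizing `f` over `S`. -/
def IsSecondOrderDStationary (f : E → ℝ) (S : Set E) (x : E) : Prop :=
  IsDStationary f S x ∧ TwiceDirDifferentiableAt f x ∧
    ∀ d ∈ radialCone S x, HasDirDeriv f x d 0 → ∃ q : ℝ, HasDirDeriv2 f x d q ∧ 0 ≤ q

/-- The set of global minimizers of `f` over `S`. -/
def globalMinimizers (f : E → ℝ) (S : Set E) : Set E :=
  {x | x ∈ S ∧ ∀ x' ∈ S, f x ≤ f x'}

end Stationarity

namespace RNN

/-- Coordinates of the network parameter `θ = (A, V, W, b, c)`. -/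
abbrev ParamIdx (N₀ N₁ N₂ : ℕ) : Type :=
  (Fin N₁ × Fin N₀) ⊕ (Fin N₂ × Fin N₁) ⊕ (Fin N₁ × Fin N₁) ⊕ Fin N₁ ⊕ Fin N₂

/-- Coordinates of the auxiliary variables `(w, s, v, r)`, each with three time steps. -/
abbrev AuxIdx (N₁ N₂ : ℕ) : Type :=
  (Fin 3 × Fin N₁) ⊕ (Fin 3 × Fin N₁) ⊕ (Fin 3 × Fin N₂) ⊕ (Fin 3 × Fin N₂)

/-- The Euclidean space of all variables `z = (θ, u)`, which is also the space of directions.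
Its coordinates are labelled by the blocks they belong to. -/
abbrev Point (N₀ N₁ N₂ : ℕ) : Type := EuclideanSpace ℝ (ParamIdx N₀ N₁ N₂ ⊕ AuxIdx N₁ N₂)

namespace Point

variable {N₀ N₁ N₂ : ℕ}

def A (z : Point N₀ N₁ N₂) : Matrix (Fin N₁) (Fin N₀) ℝ :=
  Matrix.of fun i j => z (.inl (.inl (i, j)))

def V (z : Point N₀ N₁ N₂) : Matrix (Fin N₂) (Fin N₁) ℝ :=
  Matrix.of fun i j => z (.inl (.inr (.inl (i, j))))

def W (z : Point N₀ N₁ N₂) : Matrix (Fin N₁) (Fin N₁) ℝ :=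
  Matrix.of fun i j => z (.inl (.inr (.inr (.inl (i, j)))))

def b (z : Point N₀ N₁ N₂) : Fin N₁ → ℝ :=
  fun i => z (.inl (.inr (.inr (.inr (.inl i)))))

def c (z : Point N₀ N₁ N₂) : Fin N₂ → ℝ :=
  fun i => z (.inl (.inr (.inr (.inr (.inr i)))))

def w (z : Point N₀ N₁ N₂) (t : Fin 3) : Fin N₁ → ℝ :=
  fun i => z (.inr (.inl (t, i)))

def s (z : Point N₀ N₁ N₂) (t : Fin 3) : Fin N₁ → ℝ :=
  fun i => z (.inr (.inr (.inl (t, i))))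

def v (z : Point N₀ N₁ N₂) (t : Fin 3) : Fin N₂ → ℝ :=
  fun i => z (.inr (.inr (.inr (.inl (t, i)))))

def r (z : Point N₀ N₁ N₂) (t : Fin 3) : Fin N₂ → ℝ :=
  fun i => z (.inr (.inr (.inr (.inr (t, i)))))

/-- The hidden value at the previous time step, which is `0` before the first one.
The time steps are indexed by `0, 1, 2`. -/
def sPrev (z : Point N₀ N₁ N₂) : Fin 3 → Fin N₁ → ℝ := ![0, z.s 0, z.s 1]

end Point

variable {N₀ N₁ N₂ : ℕ}

/-- The (leaky) ReLU activation function. -/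
noncomputable def sigma (α : ℝ) (u : ℝ) : ℝ := max u (α * u)

/-- The feasible set of the constrained training problem. -/
def feasible (x : Fin 3 → Fin N₀ → ℝ) (α : ℝ) : Set (Point N₀ N₁ N₂) :=
  {z | ∀ t : Fin 3,
    z.w t = z.W *ᵥ z.sPrev t + z.A *ᵥ x t + z.b ∧
    (∀ i, z.s t i = sigma α (z.w t i)) ∧
    z.v t = z.V *ᵥ z.s t + z.c ∧
    (∀ i, z.r t i = sigma α (z.v t i))}

/-- The squared Euclidean norm of the parameter, i.e. the sum of the squared Frobenius norms of
`A`, `V`, `W` and of the squared Euclidean norms of `b`, `c`. -/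
def paramNormSq (z : Point N₀ N₁ N₂) : ℝ :=
  ∑ i, ∑ j, z.A i j ^ 2 + ∑ i, ∑ j, z.V i j ^ 2 + ∑ i, ∑ j, z.W i j ^ 2 +
    ∑ i, z.b i ^ 2 + ∑ i, z.c i ^ 2

/-- The objective of the constrained training problem. -/
noncomputable def F (y : Fin 3 → Fin N₂ → ℝ) (lam : ℝ) (z : Point N₀ N₁ N₂) : ℝ :=
  (∑ t, ∑ i, (z.r t i - y t i) ^ 2) / 6 + lam * paramNormSq z

/-- The `ℓ₁`-norm of a vector. -/
def l1 {N : ℕ} (a : Fin N → ℝ) : ℝ := ∑ i, |a i|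

/-- The objective of the `ℓ₁`-penalized training problem. -/
noncomputable def Theta (x : Fin 3 → Fin N₀ → ℝ) (y : Fin 3 → Fin N₂ → ℝ) (α lam β₁ β₂ : ℝ)
    (z : Point N₀ N₁ N₂) : ℝ :=
  F y lam z +
    β₁ * ∑ t, (l1 (z.w t - z.W *ᵥ z.sPrev t - z.A *ᵥ x t - z.b) +
      l1 (fun i => z.s t i - sigma α (z.w t i))) +
    β₂ * ∑ t, (l1 (z.v t - z.V *ᵥ z.s t - z.c) +
      l1 (fun i => z.r t i - sigma α (z.v t i)))

/-- `γ_y = ‖y‖² / 6`. -/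
noncomputable def gammaY (y : Fin 3 → Fin N₂ → ℝ) : ℝ := (∑ t, ∑ i, y t i ^ 2) / 6

/-- `γ₁ = ∑_{i=0}^{2} (√(γ_y / λ))^i`. -/
noncomputable def gammaOne (y : Fin 3 → Fin N₂ → ℝ) (lam : ℝ) : ℝ :=
  ∑ i ∈ Finset.range 3, Real.sqrt (gammaY y / lam) ^ i

end RNN

/-!
The network equations are polynomial of degree two apart from the piecewise linear activation
`sigma α` and the absolute values in the penalty. Hence along every ray both objectives coincide,
for small step sizes, with a quadratic polynomial (`HasQuadGerm`); its coefficients are the first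
and second directional derivatives. This makes the penalized objective `Theta` twice directionally
differentiable and reduces its second-order necessary conditions to those of a quadratic polynomial
on a half-line. The objective `F` is a diagonal quadratic form, with explicit gradient and Hessian.

The feasible set is the graph of the map that unrolls the recurrence from the parameters. The
difference quotients of feasible points propagate through the recurrence, because `sigma α` is
Hadamard directionally differentiable, so the tangent cone is the solution set `linCone` of the
linearized equations (`bouligandCone_feasible`). Along a tangent direction the equations fail only
by the products `τ² D_V d_s` and `τ² D_W d_s`, whose vanishing describes the radial cone
(`radialCone_feasible`).

Exactness rests on the sensitivity estimate `abs_inner_gradF_sub_le`. If two directions have the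
same parameter part and the second solves the linearized equations, then their output parts differ
by the linearized residuals of the first, propagated through `V` and up to two applications of `W`.
On the level set `F ≤ γ_y` one has `‖V‖, ‖W‖ ≤ √(γ_y / λ)`, and the gradient of `F` with respect
to each output `r_t` is at most `√(2 γ_y / 3)`; the resulting constants are exactly the two
thresholds. The estimate is used twice.

* At an infeasible point, take the direction with zero parameter part whose linearized residuals are
  the negatives of the residuals. The penalty decreases along it at a rate that beats the change
  of `F`, so d-stationary points of `Theta` in the level set are feasible
  (`mem_feasible_of_forall_dTheta_nonneg`).
* At a feasible point, compare any direction with the tangent direction that has the same parameter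
  part. The penalty pays for the difference, so d-stationarity passes from `F` on the feasible set
  to `Theta` (`isDStationary_F_iff_Theta`).

Minimizers exist because bounding `Theta` bounds the parameters and the residuals, and then the
recurrence bounds all other variables (`isBounded_level_Theta`).
-/

/-! ### Germs of quadratic polynomials and directional derivatives -/

section Germs

/-- `g τ = a + τ b + τ² c` for all sufficiently small `τ > 0`. -/
def HasQuadGerm (g : ℝ → ℝ) (a b c : ℝ) : Prop :=
  ∀ᶠ τ in 𝓝[>] (0 : ℝ), g τ = a + τ * b + τ ^ 2 * c

theorem HasQuadGerm.add {g g' : ℝ → ℝ} {a b c a' b' c' : ℝ} (h : HasQuadGerm g a b c)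
    (h' : HasQuadGerm g' a' b' c') :
    HasQuadGerm (fun τ => g τ + g' τ) (a + a') (b + b') (c + c') := by
  filter_upwards [h, h'] with τ h1 h2
  rw [h1, h2]; ring

theorem HasQuadGerm.const_mul {g : ℝ → ℝ} {a b c : ℝ} (k : ℝ) (h : HasQuadGerm g a b c) :
    HasQuadGerm (fun τ => k * g τ) (k * a) (k * b) (k * c) := by
  filter_upwards [h] with τ h1
  rw [h1]; ring

theorem HasQuadGerm.sum {ι : Type*} [Fintype ι] {g : ι → ℝ → ℝ} {a b c : ι → ℝ}
    (h : ∀ i, HasQuadGerm (g i) (a i) (b i) (c i)) :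
    HasQuadGerm (fun τ => ∑ i, g i τ) (∑ i, a i) (∑ i, b i) (∑ i, c i) := by
  filter_upwards [eventually_all.2 h] with τ h1
  simp only [h1, Finset.sum_add_distrib, Finset.mul_sum]

variable {E : Type*} [NormedAddCommGroup E] [NormedSpace ℝ E]

theorem HasDirDeriv.unique {f : E → ℝ} {x d : E} {l l' : ℝ} (h : HasDirDeriv f x d l)
    (h' : HasDirDeriv f x d l') : l = l' :=
  tendsto_nhds_unique h h'

theorem HasDirDeriv2.unique {f : E → ℝ} {x d : E} {q q' : ℝ} (h : HasDirDeriv2 f x d q)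
    (h' : HasDirDeriv2 f x d q') : q = q' := by
  obtain ⟨l, hl, hq⟩ := h
  obtain ⟨l', hl', hq'⟩ := h'
  obtain rfl := hl.unique hl'
  exact tendsto_nhds_unique hq hq'

theorem HasQuadGerm.hasDirDeriv {f : E → ℝ} {x d : E} {b c : ℝ}
    (h : HasQuadGerm (fun τ => f (x + τ • d)) (f x) b c) : HasDirDeriv f x d b := by
  have hlim : Tendsto (fun τ : ℝ => b + τ * c) (𝓝[>] 0) (𝓝 b) := by
    have : Tendsto (fun τ : ℝ => b + τ * c) (𝓝 0) (𝓝 (b + 0 * c)) :=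
      Continuous.tendsto (by fun_prop) _
    simpa using this.mono_left nhdsWithin_le_nhds
  refine hlim.congr' ?_
  filter_upwards [h, self_mem_nhdsWithin] with τ hτ (hpos : 0 < τ)
  rw [hτ]; field_simp; ring

theorem HasQuadGerm.hasDirDeriv2 {f : E → ℝ} {x d : E} {b c : ℝ}
    (h : HasQuadGerm (fun τ => f (x + τ • d)) (f x) b c) : HasDirDeriv2 f x d (2 * c) := by
  refine ⟨b, h.hasDirDeriv, tendsto_const_nhds.congr' ?_⟩
  filter_upwards [h, self_mem_nhdsWithin] with τ hτ (hpos : 0 < τ)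
  rw [hτ]; field_simp; ring

theorem exists_pos_of_eventually_nhdsGT {p : ℝ → Prop} (h : ∀ᶠ τ in 𝓝[>] (0 : ℝ), p τ) :
    ∃ τ, 0 < τ ∧ p τ :=
  (Eventually.and (self_mem_nhdsWithin : Set.Ioi (0 : ℝ) ∈ 𝓝[>] 0) h).exists

theorem eventually_add_mul_pos {a : ℝ} (ha : 0 < a) (b : ℝ) :
    ∀ᶠ τ in 𝓝[>] (0 : ℝ), 0 < a + τ * b := by
  have : Tendsto (fun τ : ℝ => a + τ * b) (𝓝 0) (𝓝 (a + 0 * b)) :=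
    Continuous.tendsto (by fun_prop) _
  exact (this.mono_left nhdsWithin_le_nhds).eventually (lt_mem_nhds (by simpa using ha))

theorem eventually_quad_pos {a b : ℝ} (c : ℝ) (h : 0 < a ∨ a = 0 ∧ 0 < b) :
    ∀ᶠ τ in 𝓝[>] (0 : ℝ), 0 < a + τ * b + τ ^ 2 * c := by
  rcases h with ha | ⟨rfl, hb⟩
  · have : Tendsto (fun τ : ℝ => a + τ * b + τ ^ 2 * c) (𝓝 0) (𝓝 (a + 0 * b + 0 ^ 2 * c)) :=
      Continuous.tendsto (by fun_prop) _
    exact (this.mono_left nhdsWithin_le_nhds).eventually (lt_mem_nhds (by simpa using ha))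
  · filter_upwards [eventually_add_mul_pos hb c, self_mem_nhdsWithin] with τ h1 (h2 : 0 < τ)
    nlinarith [mul_pos h2 h1]

/-- A quadratic germ whose values are eventually at least its value at the base point has
nonnegative slope, and nonnegative curvature if its slope vanishes. -/
theorem HasQuadGerm.nonneg_of_le {g : ℝ → ℝ} {a b c : ℝ} (h : HasQuadGerm g a b c)
    (hmin : ∀ᶠ τ in 𝓝[>] (0 : ℝ), a ≤ g τ) : 0 ≤ b ∧ (b = 0 → 0 ≤ c) := by
  constructor
  · by_contra! hb
    obtain ⟨τ, -, h1, h2, h3⟩ := exists_pos_of_eventually_nhdsGT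
      (h.and (hmin.and (eventually_quad_pos (a := 0) (b := -b) (-c) (Or.inr ⟨rfl, by linarith⟩))))
    linarith
  · rintro rfl
    obtain ⟨τ, h0, h1, h2⟩ := exists_pos_of_eventually_nhdsGT (h.and hmin)
    by_contra! hc
    nlinarith [mul_pos (pow_pos h0 2) (neg_pos.2 hc)]

end Germs

/-! ### The leaky ReLU -/

namespace RNN

theorem sigma_of_nonneg {α u : ℝ} (hα : α < 1) (hu : 0 ≤ u) : sigma α u = u :=
  max_eq_left (by nlinarith)

theorem sigma_of_nonpos {α u : ℝ} (hα : α < 1) (hu : u ≤ 0) : sigma α u = α * u :=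
  max_eq_right (by nlinarith)

theorem sigma_zero (α : ℝ) : sigma α 0 = 0 := by simp [sigma]

theorem sigma_mul {α t : ℝ} (ht : 0 ≤ t) (u : ℝ) : sigma α (t * u) = t * sigma α u := by
  rw [sigma, sigma, mul_max_of_nonneg _ _ ht]; ring_nf

/-- The absolute value is the case `α = -1`, so facts about `sigma α` that only need `-1 ≤ α < 1`
also cover the `ℓ₁`-penalty. -/
theorem abs_eq_sigma (u : ℝ) : |u| = sigma (-1) u := by
  simp [sigma, abs_eq_max_neg]

theorem abs_sigma_sub_le {α : ℝ} (hα₀ : -1 ≤ α) (hα₁ : α < 1) (u u' : ℝ) :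
    |sigma α u - sigma α u'| ≤ |u - u'| := by
  have h := abs_max_sub_max_le_max u (α * u) u' (α * u')
  refine h.trans (max_le le_rfl ?_)
  rw [← mul_sub, abs_mul]
  exact mul_le_of_le_one_left (abs_nonneg _) (abs_le.2 ⟨hα₀, hα₁.le⟩)

theorem lipschitzWith_sigma {α : ℝ} (hα₀ : -1 ≤ α) (hα₁ : α < 1) :
    LipschitzWith 1 (sigma α) :=
  LipschitzWith.of_dist_le_mul fun u u' => by
    simpa [Real.dist_eq] using abs_sigma_sub_le hα₀ hα₁ u u'

/-- The one-sided directional derivative of `sigma α` at `u` along `h`, for `α < 1`. -/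
noncomputable def dsigma (α u h : ℝ) : ℝ :=
  if 0 < u then h else if u < 0 then α * h else sigma α h

theorem dsigma_zero_left (α h : ℝ) : dsigma α 0 h = sigma α h := by simp [dsigma]

theorem dsigma_zero_right (α u : ℝ) : dsigma α u 0 = 0 := by simp [dsigma, sigma_zero]

theorem dsigma_abs_neg_self (u : ℝ) : dsigma (-1) u (-u) = -|u| := by
  rcases lt_trichotomy u 0 with h | rfl | h
  · simp [dsigma, h, h.not_gt, abs_of_neg h]
  · simp [dsigma, sigma_zero]
  · simp [dsigma, h, abs_of_pos h]

theorem abs_dsigma_sub_le {α : ℝ} (hα₀ : -1 ≤ α) (hα₁ : α < 1) (u h h' : ℝ) :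
    |dsigma α u h - dsigma α u h'| ≤ |h - h'| := by
  unfold dsigma
  split_ifs
  · exact le_rfl
  · rw [← mul_sub, abs_mul]
    exact mul_le_of_le_one_left (abs_nonneg _) (abs_le.2 ⟨hα₀, hα₁.le⟩)
  · exact abs_sigma_sub_le hα₀ hα₁ h h'

/-- Composition with the piecewise linear function `sigma α` preserves quadratic germs. -/
theorem exists_hasQuadGerm_sigma {α : ℝ} (hα : α < 1) {g : ℝ → ℝ} {a b c : ℝ}
    (h : HasQuadGerm g a b c) :
    ∃ c', HasQuadGerm (fun τ => sigma α (g τ)) (sigma α a) (dsigma α a b) c' := by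
  have hneg : (a < 0 ∨ a = 0 ∧ b < 0) → ∀ᶠ τ in 𝓝[>] (0 : ℝ), g τ < 0 := by
    intro h'
    have := eventually_quad_pos (a := -a) (b := -b) (-c) (by simpa using h')
    filter_upwards [h, this] with τ h1 h2
    linarith
  have hpos : (0 < a ∨ a = 0 ∧ 0 < b) → ∀ᶠ τ in 𝓝[>] (0 : ℝ), 0 < g τ := by
    intro h'
    filter_upwards [h, eventually_quad_pos c h'] with τ h1 h2
    rwa [h1]
  rcases lt_trichotomy a 0 with ha | rfl | ha
  · refine ⟨α * c, ?_⟩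
    filter_upwards [h, hneg (Or.inl ha)] with τ h1 h2
    rw [sigma_of_nonpos hα h2.le, sigma_of_nonpos hα ha.le, h1, dsigma, if_neg ha.not_gt,
      if_pos ha]
    ring
  · rcases lt_trichotomy b 0 with hb | rfl | hb
    · refine ⟨α * c, ?_⟩
      filter_upwards [h, hneg (Or.inr ⟨rfl, hb⟩)] with τ h1 h2
      rw [sigma_of_nonpos hα h2.le, sigma_zero, h1, dsigma_zero_left, sigma_of_nonpos hα hb.le]
      ring
    · refine ⟨sigma α c, ?_⟩
      filter_upwards [h] with τ h1
      rw [h1, dsigma_zero_left, sigma_zero, ← sigma_mul (sq_nonneg τ)]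
      ring_nf
    · refine ⟨c, ?_⟩
      filter_upwards [h, hpos (Or.inr ⟨rfl, hb⟩)] with τ h1 h2
      rw [sigma_of_nonneg hα h2.le, sigma_zero, h1, dsigma_zero_left, sigma_of_nonneg hα hb.le]
  · refine ⟨c, ?_⟩
    filter_upwards [h, hpos (Or.inl ha)] with τ h1 h2
    rw [sigma_of_nonneg hα h2.le, sigma_of_nonneg hα ha.le, h1, dsigma, if_pos ha]

/-- Near its base point `sigma α` is exactly positively linear along each direction. -/
theorem eventually_sigma_add_mul {α : ℝ} (hα : α < 1) (u h : ℝ) :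
    ∀ᶠ τ in 𝓝[>] (0 : ℝ), sigma α (u + τ * h) = sigma α u + τ * dsigma α u h := by
  rcases lt_trichotomy u 0 with hu | rfl | hu
  · filter_upwards [eventually_add_mul_pos (neg_pos.2 hu) (-h)] with τ h2
    rw [sigma_of_nonpos hα (by linarith), sigma_of_nonpos hα hu.le, dsigma, if_neg hu.not_gt,
      if_pos hu]
    ring
  · filter_upwards [self_mem_nhdsWithin] with τ (h2 : 0 < τ)
    rw [zero_add, sigma_mul h2.le, sigma_zero, dsigma_zero_left, zero_add]
  · filter_upwards [eventually_add_mul_pos hu h] with τ h2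
    rw [sigma_of_nonneg hα h2.le, sigma_of_nonneg hα hu.le, dsigma, if_pos hu]

theorem hasDirDeriv_sigma_iff {α : ℝ} (hα : α < 1) (u h l : ℝ) :
    HasDirDeriv (sigma α) u h l ↔ l = dsigma α u h := by
  have key : HasDirDeriv (sigma α) u h (dsigma α u h) := by
    refine HasQuadGerm.hasDirDeriv (c := 0) ?_
    filter_upwards [eventually_sigma_add_mul hα u h] with τ h1
    simpa using h1
  exact ⟨fun h' => h'.unique key, fun h' => h' ▸ key⟩

end RNN

/-! ### The objective as a diagonal quadratic form -/

namespace RNN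

variable {N₀ N₁ N₂ : ℕ}

/-- The weight of each coordinate in the objective `F`. -/
noncomputable def weight (lam : ℝ) : ParamIdx N₀ N₁ N₂ ⊕ AuxIdx N₁ N₂ → ℝ :=
  Sum.elim (fun _ => lam) (Sum.elim 0 (Sum.elim 0 (Sum.elim 0 fun _ => 1 / 6)))

/-- The point at which the quadratic objective `F` vanishes. -/
noncomputable def center (y : Fin 3 → Fin N₂ → ℝ) : Point N₀ N₁ N₂ :=
  WithLp.toLp 2 (Sum.elim 0 (Sum.elim 0 (Sum.elim 0 (Sum.elim 0 fun j => y j.1 j.2))))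

theorem F_eq_sum (y : Fin 3 → Fin N₂ → ℝ) (lam : ℝ) (z : Point N₀ N₁ N₂) :
    F y lam z = ∑ i, weight lam i * (z i - center y i) ^ 2 := by
  simp [F, paramNormSq, Fintype.sum_sum_type, Fintype.sum_prod_type, weight, center, Point.A,
    Point.V, Point.W, Point.b, Point.c, Point.r, ← Finset.mul_sum]
  ring

/-- The gradient of `F`. -/
noncomputable def gradF (y : Fin 3 → Fin N₂ → ℝ) (lam : ℝ) (z : Point N₀ N₁ N₂) :
    Point N₀ N₁ N₂ :=
  WithLp.toLp 2 fun i => 2 * weight lam i * (z i - center y i)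

/-- The (constant) Hessian of `F`. -/
noncomputable def hessF (lam : ℝ) : Point N₀ N₁ N₂ →L[ℝ] Point N₀ N₁ N₂ :=
  LinearMap.toContinuousLinearMap
    { toFun := fun d => WithLp.toLp 2 fun i => 2 * weight lam i * d i
      map_add' := fun d d' => by ext i; simp [mul_add]
      map_smul' := fun k d => by ext i; simp; ring }

theorem hessF_apply (lam : ℝ) (d : Point N₀ N₁ N₂) (i) :
    hessF lam d i = 2 * weight lam i * d i := rfl

theorem F_add (y : Fin 3 → Fin N₂ → ℝ) (lam : ℝ) (z d : Point N₀ N₁ N₂) :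
    F y lam (z + d) = F y lam z + inner ℝ (gradF y lam z) d + inner ℝ d (hessF lam d) / 2 := by
  simp only [F_eq_sum, PiLp.inner_apply, RCLike.inner_apply, conj_trivial, gradF, hessF_apply,
    PiLp.add_apply, Finset.sum_div, ← Finset.sum_add_distrib]
  exact Finset.sum_congr rfl fun i _ => by ring

theorem F_add_smul (y : Fin 3 → Fin N₂ → ℝ) (lam : ℝ) (z d : Point N₀ N₁ N₂) (τ : ℝ) :
    F y lam (z + τ • d) = F y lam z + τ * inner ℝ (gradF y lam z) d +
      τ ^ 2 * (inner ℝ d (hessF lam d) / 2) := by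
  rw [F_add, map_smul, inner_smul_right, inner_smul_left, inner_smul_right]
  simp; ring

theorem hasQuadGerm_F (y : Fin 3 → Fin N₂ → ℝ) (lam : ℝ) (z d : Point N₀ N₁ N₂) :
    HasQuadGerm (fun τ => F y lam (z + τ • d)) (F y lam z) (inner ℝ (gradF y lam z) d)
      (inner ℝ d (hessF lam d) / 2) :=
  Eventually.of_forall fun τ => F_add_smul y lam z d τ

theorem contDiff_F (y : Fin 3 → Fin N₂ → ℝ) (lam : ℝ) {n : WithTop ℕ∞} :
    ContDiff ℝ n (F y lam : Point N₀ N₁ N₂ → ℝ) := by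
  rw [funext (F_eq_sum y lam)]
  fun_prop

theorem hasGradientAt_F (y : Fin 3 → Fin N₂ → ℝ) (lam : ℝ) (z : Point N₀ N₁ N₂) :
    HasGradientAt (F y lam) (gradF y lam z) z := by
  have hd : DifferentiableAt ℝ (F y lam) z :=
    (contDiff_F y lam (n := 1)).differentiable (by simp) z
  suffices h : InnerProductSpace.toDual ℝ _ (gradF y lam z) = fderiv ℝ (F y lam) z by
    rw [hasGradientAt_iff_hasFDerivAt, h]
    exact hd.hasFDerivAt
  refine ContinuousLinearMap.ext fun d => ?_
  -- Both sides are the one-sided derivative of `F` along `d`.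
  have h1 := (hd.hasFDerivAt.hasLineDerivAt d).tendsto_slope_zero_right
  have h2 := (hasQuadGerm_F y lam z d).hasDirDeriv
  rw [InnerProductSpace.toDual_apply_apply]
  refine tendsto_nhds_unique (h2.congr fun τ => ?_) h1
  simp [div_eq_inv_mul]

theorem gradient_F (y : Fin 3 → Fin N₂ → ℝ) (lam : ℝ) :
    gradient (F y lam : Point N₀ N₁ N₂ → ℝ) = gradF y lam :=
  funext fun z => (hasGradientAt_F y lam z).gradient

theorem fderiv_gradF (y : Fin 3 → Fin N₂ → ℝ) (lam : ℝ) (z : Point N₀ N₁ N₂) :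
    fderiv ℝ (gradF y lam : Point N₀ N₁ N₂ → _) z = hessF lam := by
  have : (gradF y lam : Point N₀ N₁ N₂ → _) = fun z => hessF lam z - hessF lam (center y) := by
    ext z i
    simp only [PiLp.sub_apply, hessF_apply, gradF]
    ring
  rw [this]
  exact ((hessF lam).hasFDerivAt.sub_const _).fderiv

/-! ### Stationarity for the constrained problem -/

theorem hasDirDeriv_F_iff (y : Fin 3 → Fin N₂ → ℝ) (lam : ℝ) (z d : Point N₀ N₁ N₂) (l : ℝ) :
    HasDirDeriv (F y lam) z d l ↔ l = inner ℝ (gradF y lam z) d :=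
  have h := (hasQuadGerm_F y lam z d).hasDirDeriv
  ⟨fun h' => h'.unique h, fun h' => h' ▸ h⟩

theorem hasDirDeriv2_F_iff (y : Fin 3 → Fin N₂ → ℝ) (lam : ℝ) (z d : Point N₀ N₁ N₂) (q : ℝ) :
    HasDirDeriv2 (F y lam) z d q ↔ q = inner ℝ d (hessF lam d) := by
  have h := (hasQuadGerm_F y lam z d).hasDirDeriv2
  rw [mul_div_cancel₀ _ (two_ne_zero' ℝ)] at h
  exact ⟨fun h' => h'.unique h, fun h' => h' ▸ h⟩

theorem isDStationary_F_iff (y : Fin 3 → Fin N₂ → ℝ) (lam : ℝ) (S : Set (Point N₀ N₁ N₂))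
    (z : Point N₀ N₁ N₂) :
    IsDStationary (F y lam) S z ↔
      z ∈ S ∧ ∀ d ∈ bouligandCone S z, 0 ≤ inner ℝ (gradF y lam z) d := by
  simp only [IsDStationary, hasDirDeriv_F_iff, exists_eq_left]

theorem isSecondOrderDStationary_F_iff (y : Fin 3 → Fin N₂ → ℝ) (lam : ℝ)
    (S : Set (Point N₀ N₁ N₂)) (z : Point N₀ N₁ N₂) :
    IsSecondOrderDStationary (F y lam) S z ↔
      z ∈ S ∧ (∀ d ∈ bouligandCone S z, 0 ≤ inner ℝ (gradF y lam z) d) ∧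
      ∀ d ∈ radialCone S z, inner ℝ (gradF y lam z) d = 0 → 0 ≤ inner ℝ d (hessF lam d) := by
  have h : TwiceDirDifferentiableAt (F y lam) z := fun d =>
    ⟨_, (hasDirDeriv2_F_iff y lam z d _).2 rfl⟩
  simp only [IsSecondOrderDStationary, isDStationary_F_iff, hasDirDeriv_F_iff, h, true_and,
    hasDirDeriv2_F_iff, exists_eq_left, and_assoc, eq_comm (a := (0 : ℝ))]

/-- Bouligand tangent directions are the limits of difference quotients, so a local minimizer
over an arbitrary set satisfies the first-order condition; along radial directions the objective is
exactly quadratic, which gives the second-order condition. -/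
theorem isSecondOrderDStationary_F_of_isLocalMinOn (y : Fin 3 → Fin N₂ → ℝ) (lam : ℝ)
    {S : Set (Point N₀ N₁ N₂)} {z : Point N₀ N₁ N₂} (hz : z ∈ S)
    (hmin : IsLocalMinOn (F y lam) S z) : IsSecondOrderDStationary (F y lam) S z := by
  rw [isSecondOrderDStationary_F_iff]
  refine ⟨hz, ?_, ?_⟩
  · rintro d ⟨p, τ, hpS, hp, hτ, hτ0, hd⟩
    have hev : ∀ᶠ k in atTop, F y lam z ≤ F y lam (p k) :=
      (tendsto_nhdsWithin_iff.2 ⟨hp, Eventually.of_forall hpS⟩).eventually hmin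
    have hlim : Tendsto (fun k => inner ℝ (gradF y lam z) ((τ k)⁻¹ • (p k - z)) +
        inner ℝ ((τ k)⁻¹ • (p k - z)) (hessF lam (p k - z)) / 2) atTop
        (𝓝 (inner ℝ (gradF y lam z) d + inner ℝ d (hessF lam (z - z)) / 2)) := by
      refine (tendsto_const_nhds.inner hd).add ((hd.inner ?_).div_const 2)
      exact ((hessF lam).continuous.tendsto _).comp (hp.sub_const z)
    simp only [sub_self, map_zero, inner_zero_right, zero_div, add_zero] at hlim
    refine ge_of_tendsto hlim ?_
    filter_upwards [hev] with k hk
    have h1 := F_add y lam z (p k - z)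
    rw [add_sub_cancel] at h1
    rw [inner_smul_right, inner_smul_left, conj_trivial, mul_div_assoc, ← mul_add]
    exact mul_nonneg (inv_nonneg.2 (hτ k).le) (by linarith)
  · rintro d ⟨τ, hτ, hτ0, hS⟩ h0
    have hp : Tendsto (fun k => z + τ k • d) atTop (𝓝 z) := by
      simpa using tendsto_const_nhds.add (hτ0.smul_const d)
    have hev : ∀ᶠ k in atTop, F y lam z ≤ F y lam (z + τ k • d) :=
      (tendsto_nhdsWithin_iff.2 ⟨hp, Eventually.of_forall hS⟩).eventually hmin
    obtain ⟨k, hk⟩ := hev.exists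
    rw [F_add_smul, h0] at hk
    have := pow_pos (hτ k) 2
    by_contra! hneg
    nlinarith

end RNN

/-! ### Residuals of the network equations and their linearizations -/

namespace RNN

variable {N₀ N₁ N₂ : ℕ}

/-- Residual of the equation defining the hidden pre-activation. -/
def resW (x : Fin 3 → Fin N₀ → ℝ) (z : Point N₀ N₁ N₂) (t : Fin 3) : Fin N₁ → ℝ :=
  z.w t - z.W *ᵥ z.sPrev t - z.A *ᵥ x t - z.b

/-- Residual of the equation defining the hidden value. -/
noncomputable def resS (α : ℝ) (z : Point N₀ N₁ N₂) (t : Fin 3) : Fin N₁ → ℝ :=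
  fun i => z.s t i - sigma α (z.w t i)

/-- Residual of the equation defining the output pre-activation. -/
def resV (z : Point N₀ N₁ N₂) (t : Fin 3) : Fin N₂ → ℝ :=
  z.v t - z.V *ᵥ z.s t - z.c

/-- Residual of the equation defining the output. -/
noncomputable def resR (α : ℝ) (z : Point N₀ N₁ N₂) (t : Fin 3) : Fin N₂ → ℝ :=
  fun i => z.r t i - sigma α (z.v t i)

/-- Directional derivative of `resW` at `z` along `d`. -/
def linW (x : Fin 3 → Fin N₀ → ℝ) (z d : Point N₀ N₁ N₂) (t : Fin 3) : Fin N₁ → ℝ :=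
  d.w t - (d.W *ᵥ z.sPrev t + z.W *ᵥ d.sPrev t + d.A *ᵥ x t + d.b)

/-- Directional derivative of `resS` at `z` along `d`. -/
noncomputable def linS (α : ℝ) (z d : Point N₀ N₁ N₂) (t : Fin 3) : Fin N₁ → ℝ :=
  fun i => d.s t i - dsigma α (z.w t i) (d.w t i)

/-- Directional derivative of `resV` at `z` along `d`. -/
def linV (z d : Point N₀ N₁ N₂) (t : Fin 3) : Fin N₂ → ℝ :=
  d.v t - (d.V *ᵥ z.s t + z.V *ᵥ d.s t + d.c)

/-- Directional derivative of `resR` at `z` along `d`. -/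
noncomputable def linR (α : ℝ) (z d : Point N₀ N₁ N₂) (t : Fin 3) : Fin N₂ → ℝ :=
  fun i => d.r t i - dsigma α (z.v t i) (d.v t i)

theorem mem_feasible_iff {x : Fin 3 → Fin N₀ → ℝ} {α : ℝ} {z : Point N₀ N₁ N₂} :
    z ∈ feasible x α ↔ ∀ t, resW x z t = 0 ∧ resS α z t = 0 ∧ resV z t = 0 ∧ resR α z t = 0 := by
  simp only [feasible, Set.mem_ofPred_eq, resW, resV]
  refine forall_congr' fun t => and_congr ?_ (and_congr ?_ (and_congr ?_ ?_))
  · rw [sub_sub, sub_sub, sub_eq_zero, add_assoc]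
  · simp [funext_iff, resS, sub_eq_zero]
  · rw [sub_sub, sub_eq_zero]
  · simp [funext_iff, resR, sub_eq_zero]

theorem sPrev_add_smul (z d : Point N₀ N₁ N₂) (τ : ℝ) (t : Fin 3) :
    (z + τ • d).sPrev t = z.sPrev t + τ • d.sPrev t := by
  fin_cases t
  · change (0 : Fin N₁ → ℝ) = 0 + τ • 0
    simp
  · rfl
  · rfl

theorem resW_add_smul (x : Fin 3 → Fin N₀ → ℝ) (z d : Point N₀ N₁ N₂) (τ : ℝ) (t : Fin 3) :
    resW x (z + τ • d) t =
      resW x z t + τ • linW x z d t + τ ^ 2 • -(d.W *ᵥ d.sPrev t) := by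
  have h1 : (z + τ • d).w t = z.w t + τ • d.w t := rfl
  have h2 : (z + τ • d).W = z.W + τ • d.W := rfl
  have h3 : (z + τ • d).A = z.A + τ • d.A := rfl
  have h4 : (z + τ • d).b = z.b + τ • d.b := rfl
  simp only [resW, linW, h1, h2, h3, h4, sPrev_add_smul, Matrix.add_mulVec, Matrix.mulVec_add,
    Matrix.smul_mulVec, Matrix.mulVec_smul]
  module

theorem resV_add_smul (z d : Point N₀ N₁ N₂) (τ : ℝ) (t : Fin 3) :
    resV (z + τ • d) t = resV z t + τ • linV z d t + τ ^ 2 • -(d.V *ᵥ d.s t) := by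
  have h1 : (z + τ • d).v t = z.v t + τ • d.v t := rfl
  have h2 : (z + τ • d).V = z.V + τ • d.V := rfl
  have h3 : (z + τ • d).s t = z.s t + τ • d.s t := rfl
  have h4 : (z + τ • d).c = z.c + τ • d.c := rfl
  simp only [resV, linV, h1, h2, h3, h4, Matrix.add_mulVec, Matrix.mulVec_add,
    Matrix.smul_mulVec, Matrix.mulVec_smul]
  module

theorem eventually_resS_add_smul {α : ℝ} (hα : α < 1) (z d : Point N₀ N₁ N₂) (t : Fin 3) :
    ∀ᶠ τ in 𝓝[>] (0 : ℝ), resS α (z + τ • d) t = resS α z t + τ • linS α z d t := by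
  filter_upwards [eventually_all.2 fun i => eventually_sigma_add_mul hα (z.w t i) (d.w t i)]
    with τ h
  funext i
  have h1 : (z + τ • d).w t i = z.w t i + τ * d.w t i := rfl
  have h2 : (z + τ • d).s t i = z.s t i + τ * d.s t i := rfl
  simp only [resS, linS, h1, h2, h, Pi.add_apply, Pi.smul_apply, smul_eq_mul]
  ring

theorem eventually_resR_add_smul {α : ℝ} (hα : α < 1) (z d : Point N₀ N₁ N₂) (t : Fin 3) :
    ∀ᶠ τ in 𝓝[>] (0 : ℝ), resR α (z + τ • d) t = resR α z t + τ • linR α z d t := by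
  filter_upwards [eventually_all.2 fun i => eventually_sigma_add_mul hα (z.v t i) (d.v t i)]
    with τ h
  funext i
  have h1 : (z + τ • d).v t i = z.v t i + τ * d.v t i := rfl
  have h2 : (z + τ • d).r t i = z.r t i + τ * d.r t i := rfl
  simp only [resR, linR, h1, h2, h, Pi.add_apply, Pi.smul_apply, smul_eq_mul]
  ring

/-! ### The penalized objective -/

/-- The directional derivative of the `ℓ₁`-norm at `a` along `h`. -/
noncomputable def dl1 {N : ℕ} (a h : Fin N → ℝ) : ℝ := ∑ i, dsigma (-1) (a i) (h i)

theorem dl1_zero_left {N : ℕ} (h : Fin N → ℝ) : dl1 0 h = l1 h := by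
  simp [dl1, l1, dsigma_zero_left, abs_eq_sigma]

theorem dl1_neg_self {N : ℕ} (a : Fin N → ℝ) : dl1 a (-a) = -l1 a := by
  simp [dl1, l1, dsigma_abs_neg_self]

theorem l1_nonneg {N : ℕ} (a : Fin N → ℝ) : 0 ≤ l1 a :=
  Finset.sum_nonneg fun _ _ => abs_nonneg _

theorem l1_eq_zero {N : ℕ} {a : Fin N → ℝ} : l1 a = 0 ↔ a = 0 := by
  simp [l1, Finset.sum_eq_zero_iff_of_nonneg, funext_iff]

theorem exists_hasQuadGerm_l1 {N : ℕ} {g : ℝ → Fin N → ℝ} {a b c : Fin N → ℝ}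
    (h : ∀ᶠ τ in 𝓝[>] (0 : ℝ), g τ = a + τ • b + τ ^ 2 • c) :
    ∃ c', HasQuadGerm (fun τ => l1 (g τ)) (l1 a) (dl1 a b) c' := by
  have key : ∀ i, ∃ c', HasQuadGerm (fun τ => sigma (-1) (g τ i)) (sigma (-1) (a i))
      (dsigma (-1) (a i) (b i)) c' := fun i =>
    exists_hasQuadGerm_sigma (by norm_num) (c := c i) (h.mono fun τ hτ => by simp [hτ])
  choose c' hc' using key
  simp only [l1, abs_eq_sigma]
  exact ⟨_, HasQuadGerm.sum hc'⟩

/-- The directional derivative of `Theta` at `z` along `d`. -/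
noncomputable def dTheta (x : Fin 3 → Fin N₀ → ℝ) (y : Fin 3 → Fin N₂ → ℝ) (α lam β₁ β₂ : ℝ)
    (z d : Point N₀ N₁ N₂) : ℝ :=
  inner ℝ (gradF y lam z) d +
    β₁ * ∑ t, (dl1 (resW x z t) (linW x z d t) + dl1 (resS α z t) (linS α z d t)) +
    β₂ * ∑ t, (dl1 (resV z t) (linV z d t) + dl1 (resR α z t) (linR α z d t))

theorem Theta_eq (x : Fin 3 → Fin N₀ → ℝ) (y : Fin 3 → Fin N₂ → ℝ) (α lam β₁ β₂ : ℝ)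
    (z : Point N₀ N₁ N₂) :
    Theta x y α lam β₁ β₂ z = F y lam z + β₁ * ∑ t, (l1 (resW x z t) + l1 (resS α z t)) +
      β₂ * ∑ t, (l1 (resV z t) + l1 (resR α z t)) := rfl

section Theta

variable {x : Fin 3 → Fin N₀ → ℝ} {y : Fin 3 → Fin N₂ → ℝ} {α lam β₁ β₂ : ℝ}

/-- Along every ray the penalized objective agrees with a quadratic polynomial near the base
point: all its ingredients are quadratic or piecewise linear. -/
theorem exists_hasQuadGerm_Theta (hα : α < 1) (z d : Point N₀ N₁ N₂) :
    ∃ c, HasQuadGerm (fun τ => Theta x y α lam β₁ β₂ (z + τ • d)) (Theta x y α lam β₁ β₂ z)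
      (dTheta x y α lam β₁ β₂ z d) c := by
  have hW (t : Fin 3) := exists_hasQuadGerm_l1
    (Eventually.of_forall fun τ => resW_add_smul x z d τ t)
  have hV (t : Fin 3) := exists_hasQuadGerm_l1
    (Eventually.of_forall fun τ => resV_add_smul z d τ t)
  have hS (t : Fin 3) := exists_hasQuadGerm_l1 (c := 0)
    ((eventually_resS_add_smul hα z d t).mono fun τ h => by simpa using h)
  have hR (t : Fin 3) := exists_hasQuadGerm_l1 (c := 0)
    ((eventually_resR_add_smul hα z d t).mono fun τ h => by simpa using h)
  choose cW hW using hW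
  choose cV hV using hV
  choose cS hS using hS
  choose cR hR using hR
  simp only [Theta_eq, dTheta]
  exact ⟨_, ((hasQuadGerm_F y lam z d).add
    ((HasQuadGerm.sum fun t => (hW t).add (hS t)).const_mul β₁)).add
    ((HasQuadGerm.sum fun t => (hV t).add (hR t)).const_mul β₂)⟩

theorem hasDirDeriv_Theta_iff (hα : α < 1) (z d : Point N₀ N₁ N₂) (l : ℝ) :
    HasDirDeriv (Theta x y α lam β₁ β₂) z d l ↔ l = dTheta x y α lam β₁ β₂ z d := by
  obtain ⟨c, hc⟩ := exists_hasQuadGerm_Theta (x := x) (y := y) (lam := lam) (β₁ := β₁) (β₂ := β₂)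
    hα z d
  exact ⟨fun h => h.unique hc.hasDirDeriv, fun h => h ▸ hc.hasDirDeriv⟩

theorem twiceDirDifferentiableAt_Theta (hα : α < 1) (z : Point N₀ N₁ N₂) :
    TwiceDirDifferentiableAt (Theta x y α lam β₁ β₂) z := fun d =>
  let ⟨_, hc⟩ := exists_hasQuadGerm_Theta hα z d
  ⟨_, hc.hasDirDeriv2⟩

end Theta

end RNN

/-! ### Cones and stationarity over the whole space -/

section Univ

variable {E : Type*} [NormedAddCommGroup E] [NormedSpace ℝ E]

theorem radialCone_subset_bouligandCone (S : Set E) (x : E) :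
    radialCone S x ⊆ bouligandCone S x := by
  rintro d ⟨τ, hτ, hτ0, hS⟩
  refine ⟨fun k => x + τ k • d, τ, hS, ?_, hτ, hτ0, tendsto_const_nhds.congr fun k => ?_⟩
  · simpa using tendsto_const_nhds.add (hτ0.smul_const d)
  · rw [add_sub_cancel_left, smul_smul, inv_mul_cancel₀ (hτ k).ne', one_smul]

theorem mem_radialCone_of_eventually {S : Set E} {x d : E}
    (h : ∀ᶠ τ in 𝓝[>] (0 : ℝ), x + τ • d ∈ S) : d ∈ radialCone S x := by
  have hseq : Tendsto (fun k : ℕ => 1 / ((k : ℝ) + 1)) atTop (𝓝[>] 0) :=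
    tendsto_nhdsWithin_iff.2 ⟨tendsto_one_div_add_atTop_nhds_zero_nat,
      Eventually.of_forall fun k => by simp only [Set.mem_Ioi]; positivity⟩
  obtain ⟨n, hn⟩ := eventually_atTop.1 (hseq.eventually h)
  exact ⟨fun k => 1 / (((k + n : ℕ) : ℝ) + 1), fun k => by positivity,
    (tendsto_add_atTop_iff_nat n).2 tendsto_one_div_add_atTop_nhds_zero_nat,
    fun k => hn (k + n) (by omega)⟩

theorem radialCone_univ (x : E) : radialCone Set.univ x = Set.univ :=
  Set.eq_univ_of_forall fun _ => mem_radialCone_of_eventually (by simp)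

theorem bouligandCone_univ (x : E) : bouligandCone Set.univ x = Set.univ :=
  Set.eq_univ_of_univ_subset
    ((radialCone_univ x).symm.subset.trans (radialCone_subset_bouligandCone _ x))

theorem isDStationary_univ_iff (f : E → ℝ) (x : E) :
    IsDStationary f Set.univ x ↔ ∀ d, ∃ l, HasDirDeriv f x d l ∧ 0 ≤ l := by
  simp [IsDStationary, bouligandCone_univ]

theorem isSecondOrderDStationary_univ_iff {f : E → ℝ} {x : E}
    (h : TwiceDirDifferentiableAt f x) :
    IsSecondOrderDStationary f Set.univ x ↔
      (∀ d, ∃ l, HasDirDeriv f x d l ∧ 0 ≤ l) ∧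
      ∀ d, HasDirDeriv f x d 0 → ∃ q, HasDirDeriv2 f x d q ∧ 0 ≤ q := by
  simp [IsSecondOrderDStationary, isDStationary_univ_iff, radialCone_univ, h]

end Univ

namespace RNN

variable {N₀ N₁ N₂ : ℕ} {x : Fin 3 → Fin N₀ → ℝ} {y : Fin 3 → Fin N₂ → ℝ} {α lam β₁ β₂ : ℝ}

theorem isDStationary_Theta_iff (hα : α < 1) (z : Point N₀ N₁ N₂) :
    IsDStationary (Theta x y α lam β₁ β₂) Set.univ z ↔
      ∀ d, 0 ≤ dTheta x y α lam β₁ β₂ z d := by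
  simp only [isDStationary_univ_iff, hasDirDeriv_Theta_iff hα, exists_eq_left]

theorem isSecondOrderDStationary_Theta_of_isLocalMin (hα : α < 1) {z : Point N₀ N₁ N₂}
    (hmin : IsLocalMin (Theta x y α lam β₁ β₂) z) :
    IsSecondOrderDStationary (Theta x y α lam β₁ β₂) Set.univ z := by
  have key (d : Point N₀ N₁ N₂) : ∀ᶠ τ in 𝓝[>] (0 : ℝ),
      Theta x y α lam β₁ β₂ z ≤ Theta x y α lam β₁ β₂ (z + τ • d) := by
    have : Tendsto (fun τ : ℝ => z + τ • d) (𝓝 0) (𝓝 (z + (0 : ℝ) • d)) :=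
      Continuous.tendsto (by fun_prop) _
    rw [zero_smul, add_zero] at this
    exact (this.mono_left nhdsWithin_le_nhds).eventually hmin
  rw [isSecondOrderDStationary_univ_iff (twiceDirDifferentiableAt_Theta hα z)]
  refine ⟨fun d => ?_, fun d h0 => ?_⟩ <;> obtain ⟨c, hc⟩ := exists_hasQuadGerm_Theta hα z d
  · exact ⟨_, hc.hasDirDeriv, (hc.nonneg_of_le (key d)).1⟩
  · exact ⟨_, hc.hasDirDeriv2, mul_nonneg zero_le_two
      ((hc.nonneg_of_le (key d)).2 (hc.hasDirDeriv.unique h0))⟩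

/-! ### Local Lipschitz continuity of the penalized objective -/

theorem locallyLipschitz_sum {X ι : Type*} [PseudoEMetricSpace X] (s : Finset ι) {g : ι → X → ℝ}
    (h : ∀ i, LocallyLipschitz (g i)) : LocallyLipschitz fun z => ∑ i ∈ s, g i z := by
  classical
  induction s using Finset.induction_on with
  | empty => simpa using LocallyLipschitz.const (0 : ℝ)
  | insert i s hi ih => simpa [Finset.sum_insert hi] using (h i).add ih

theorem locallyLipschitz_l1 {X : Type*} [PseudoEMetricSpace X] {N : ℕ} {g : X → Fin N → ℝ}
    (h : ∀ i, LocallyLipschitz fun z => g z i) : LocallyLipschitz fun z => l1 (g z) :=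
  locallyLipschitz_sum _ fun i => lipschitzWith_one_norm.locallyLipschitz.comp (h i)

theorem contDiff_sPrev (t : Fin 3) (i : Fin N₁) {n : WithTop ℕ∞} :
    ContDiff ℝ n fun z : Point N₀ N₁ N₂ => z.sPrev t i := by
  fin_cases t
  · exact contDiff_const
  · change ContDiff ℝ n fun z : Point N₀ N₁ N₂ => z (.inr (.inr (.inl (0, i))))
    fun_prop
  · change ContDiff ℝ n fun z : Point N₀ N₁ N₂ => z (.inr (.inr (.inl (1, i))))
    fun_prop

theorem contDiff_resW (x : Fin 3 → Fin N₀ → ℝ) (t : Fin 3) (i : Fin N₁) {n : WithTop ℕ∞} :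
    ContDiff ℝ n fun z : Point N₀ N₁ N₂ => resW x z t i := by
  have := fun j => contDiff_sPrev (N₀ := N₀) (N₁ := N₁) (N₂ := N₂) t j (n := n)
  simp only [resW, Pi.sub_apply, Matrix.mulVec, dotProduct, Point.w, Point.W, Point.A, Point.b,
    Matrix.of_apply]
  fun_prop

theorem contDiff_resV (t : Fin 3) (i : Fin N₂) {n : WithTop ℕ∞} :
    ContDiff ℝ n fun z : Point N₀ N₁ N₂ => resV z t i := by
  simp only [resV, Pi.sub_apply, Matrix.mulVec, dotProduct, Point.v, Point.V, Point.s, Point.c,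
    Matrix.of_apply]
  fun_prop

theorem locallyLipschitz_resS (hα₀ : 0 ≤ α) (hα₁ : α < 1) (t : Fin 3) (i : Fin N₁) :
    LocallyLipschitz fun z : Point N₀ N₁ N₂ => resS α z t i := by
  have hs : ContDiff ℝ 1 fun z : Point N₀ N₁ N₂ => z.s t i := by unfold Point.s; fun_prop
  have hw : ContDiff ℝ 1 fun z : Point N₀ N₁ N₂ => z.w t i := by unfold Point.w; fun_prop
  exact hs.locallyLipschitz.sub
    ((lipschitzWith_sigma (by linarith) hα₁).locallyLipschitz.comp hw.locallyLipschitz)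

theorem locallyLipschitz_resR (hα₀ : 0 ≤ α) (hα₁ : α < 1) (t : Fin 3) (i : Fin N₂) :
    LocallyLipschitz fun z : Point N₀ N₁ N₂ => resR α z t i := by
  have hr : ContDiff ℝ 1 fun z : Point N₀ N₁ N₂ => z.r t i := by unfold Point.r; fun_prop
  have hv : ContDiff ℝ 1 fun z : Point N₀ N₁ N₂ => z.v t i := by unfold Point.v; fun_prop
  exact hr.locallyLipschitz.sub
    ((lipschitzWith_sigma (by linarith) hα₁).locallyLipschitz.comp hv.locallyLipschitz)

theorem locallyLipschitz_Theta (hα₀ : 0 ≤ α) (hα₁ : α < 1) :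
    LocallyLipschitz (Theta x y α lam β₁ β₂ : Point N₀ N₁ N₂ → ℝ) := by
  have hmul (k : ℝ) : LocallyLipschitz fun u : ℝ => k * u :=
    (contDiff_const.mul contDiff_id : ContDiff ℝ 1 _).locallyLipschitz
  have hW (t : Fin 3) := locallyLipschitz_l1 fun i =>
    (contDiff_resW (N₁ := N₁) (N₂ := N₂) x t i).locallyLipschitz
  have hV (t : Fin 3) := locallyLipschitz_l1 fun i =>
    (contDiff_resV (N₀ := N₀) (N₁ := N₁) (N₂ := N₂) t i).locallyLipschitz
  have hS (t : Fin 3) := locallyLipschitz_l1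
    (locallyLipschitz_resS (N₀ := N₀) (N₁ := N₁) (N₂ := N₂) hα₀ hα₁ t)
  have hR (t : Fin 3) := locallyLipschitz_l1
    (locallyLipschitz_resR (N₀ := N₀) (N₁ := N₁) (N₂ := N₂) hα₀ hα₁ t)
  exact ((contDiff_F y lam).locallyLipschitz.add
    ((hmul β₁).comp (locallyLipschitz_sum _ fun t => (hW t).add (hS t)))).add
    ((hmul β₂).comp (locallyLipschitz_sum _ fun t => (hV t).add (hR t)))

end RNN

/-! ### Sensitivity of the objective to residuals -/

namespace RNN

variable {N₀ N₁ N₂ : ℕ}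

/-- The Euclidean norm of a vector. -/
noncomputable def l2 {N : ℕ} (a : Fin N → ℝ) : ℝ := ‖WithLp.toLp 2 a‖

theorem l2_eq_sqrt {N : ℕ} (a : Fin N → ℝ) : l2 a = √(∑ i, a i ^ 2) := by
  simp [l2, EuclideanSpace.norm_eq]

theorem l2_add_le {N : ℕ} (a b : Fin N → ℝ) : l2 (a + b) ≤ l2 a + l2 b := by
  simpa [l2] using norm_add_le (WithLp.toLp 2 a) (WithLp.toLp 2 b)

theorem l2_nonneg {N : ℕ} (a : Fin N → ℝ) : 0 ≤ l2 a := norm_nonneg _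

theorem l2_zero {N : ℕ} : l2 (0 : Fin N → ℝ) = 0 := by simp [l2]

theorem l2_le_l1 {N : ℕ} (a : Fin N → ℝ) : l2 a ≤ l1 a := by
  rw [l2_eq_sqrt, Real.sqrt_le_left (l1_nonneg a), l1]
  simpa only [sq_abs] using
    Finset.sum_sq_le_sq_sum_of_nonneg (s := Finset.univ) fun i _ => abs_nonneg (a i)

theorem l2_le_of_abs_le {N : ℕ} {a b : Fin N → ℝ} (h : ∀ i, |a i| ≤ |b i|) : l2 a ≤ l2 b := by
  rw [l2_eq_sqrt, l2_eq_sqrt]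
  exact Real.sqrt_le_sqrt (Finset.sum_le_sum fun i _ => sq_le_sq.2 (h i))

theorem abs_dotProduct_le_l2 {N : ℕ} (a b : Fin N → ℝ) : |a ⬝ᵥ b| ≤ l2 a * l2 b := by
  have := abs_real_inner_le_norm (WithLp.toLp 2 b) (WithLp.toLp 2 a)
  rwa [EuclideanSpace.inner_toLp_toLp, star_trivial, mul_comm] at this

theorem l2_mulVec_le {M N : ℕ} (B : Matrix (Fin M) (Fin N) ℝ) (a : Fin N → ℝ) :
    l2 (B *ᵥ a) ≤ √(∑ i, ∑ j, B i j ^ 2) * l2 a := by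
  rw [l2_eq_sqrt, l2_eq_sqrt, ← Real.sqrt_mul (by positivity), Finset.sum_mul]
  exact Real.sqrt_le_sqrt (Finset.sum_le_sum fun i _ =>
    Finset.sum_mul_sq_le_sq_mul_sq Finset.univ (B i) a)

section Bounds

variable {y : Fin 3 → Fin N₂ → ℝ} {lam : ℝ} {z : Point N₀ N₁ N₂} {G : ℝ}

theorem paramNormSq_nonneg (z : Point N₀ N₁ N₂) : 0 ≤ paramNormSq z := by
  unfold paramNormSq; positivity

theorem l2_output_sub_le (hlam : 0 < lam) (hF : F y lam z ≤ G) (t : Fin 3) :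
    l2 (z.r t - y t) / 3 ≤ √(2 * G / 3) := by
  have h0 := mul_nonneg hlam.le (paramNormSq_nonneg z)
  have h1 : ∑ i, (z.r t i - y t i) ^ 2 ≤ ∑ t, ∑ i, (z.r t i - y t i) ^ 2 :=
    Finset.single_le_sum (f := fun t => ∑ i, (z.r t i - y t i) ^ 2)
      (fun _ _ => Finset.sum_nonneg fun _ _ => sq_nonneg _) (Finset.mem_univ t)
  rw [F] at hF
  rw [l2_eq_sqrt, show (3 : ℝ) = √(3 ^ 2) by rw [Real.sqrt_sq (by norm_num)],
    ← Real.sqrt_div' _ (by norm_num), Real.sqrt_sq (by norm_num)]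
  refine Real.sqrt_le_sqrt ?_
  simp only [Pi.sub_apply]
  linarith

theorem paramNormSq_le (hlam : 0 < lam) (hF : F y lam z ≤ G) : paramNormSq z ≤ G / lam := by
  rw [le_div_iff₀ hlam]
  have : 0 ≤ ∑ t, ∑ i, (z.r t i - y t i) ^ 2 := by positivity
  rw [F] at hF
  linarith

theorem sum_sq_W_le (z : Point N₀ N₁ N₂) : ∑ i, ∑ j, z.W i j ^ 2 ≤ paramNormSq z := by
  have h1 : 0 ≤ ∑ i, ∑ j, z.A i j ^ 2 := by positivity
  have h2 : 0 ≤ ∑ i, ∑ j, z.V i j ^ 2 := by positivity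
  have h3 : 0 ≤ ∑ i, z.b i ^ 2 := by positivity
  have h4 : 0 ≤ ∑ i, z.c i ^ 2 := by positivity
  rw [paramNormSq]; linarith

theorem sum_sq_V_le (z : Point N₀ N₁ N₂) : ∑ i, ∑ j, z.V i j ^ 2 ≤ paramNormSq z := by
  have h1 : 0 ≤ ∑ i, ∑ j, z.A i j ^ 2 := by positivity
  have h2 : 0 ≤ ∑ i, ∑ j, z.W i j ^ 2 := by positivity
  have h3 : 0 ≤ ∑ i, z.b i ^ 2 := by positivity
  have h4 : 0 ≤ ∑ i, z.c i ^ 2 := by positivity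
  rw [paramNormSq]; linarith

end Bounds

/-- The directions annihilating the linearized network equations at `z`. -/
def linCone (x : Fin 3 → Fin N₀ → ℝ) (α : ℝ) (z : Point N₀ N₁ N₂) : Set (Point N₀ N₁ N₂) :=
  {d | ∀ t, linW x z d t = 0 ∧ linS α z d t = 0 ∧ linV z d t = 0 ∧ linR α z d t = 0}

section Sensitivity

variable {x : Fin 3 → Fin N₀ → ℝ} {α : ℝ} {z d d' : Point N₀ N₁ N₂}

/-- The difference of two directions with the same parameter part solves the linearized equations
with the parameters of `z` kept fixed, up to the linearized residual. -/
theorem l2_w_sub_le (hθ : ∀ i, d (.inl i) = d' (.inl i)) (h' : d' ∈ linCone x α z) (t : Fin 3) :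
    l2 (d.w t - d'.w t) ≤
      l1 (linW x z d t) + √(paramNormSq z) * l2 (d.sPrev t - d'.sPrev t) := by
  have hA : d.A = d'.A := by ext i j; exact hθ _
  have hW : d.W = d'.W := by ext i j; exact hθ _
  have hb : d.b = d'.b := by ext i; exact hθ _
  have h : d.w t - d'.w t = linW x z d t + z.W *ᵥ (d.sPrev t - d'.sPrev t) := by
    have := (h' t).1
    rw [linW, sub_eq_zero] at this
    rw [linW, this, hA, hW, hb, Matrix.mulVec_sub]
    module
  rw [h]
  refine (l2_add_le _ _).trans (add_le_add (l2_le_l1 _) ((l2_mulVec_le _ _).trans ?_))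
  exact mul_le_mul_of_nonneg_right (Real.sqrt_le_sqrt (sum_sq_W_le z)) (l2_nonneg _)

theorem l2_v_sub_le (hθ : ∀ i, d (.inl i) = d' (.inl i)) (h' : d' ∈ linCone x α z) (t : Fin 3) :
    l2 (d.v t - d'.v t) ≤ l1 (linV z d t) + √(paramNormSq z) * l2 (d.s t - d'.s t) := by
  have hV : d.V = d'.V := by ext i j; exact hθ _
  have hc : d.c = d'.c := by ext i; exact hθ _
  have h : d.v t - d'.v t = linV z d t + z.V *ᵥ (d.s t - d'.s t) := by
    have := (h' t).2.2.1
    rw [linV, sub_eq_zero] at this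
    rw [linV, this, hV, hc, Matrix.mulVec_sub]
    module
  rw [h]
  refine (l2_add_le _ _).trans (add_le_add (l2_le_l1 _) ((l2_mulVec_le _ _).trans ?_))
  exact mul_le_mul_of_nonneg_right (Real.sqrt_le_sqrt (sum_sq_V_le z)) (l2_nonneg _)

theorem l2_s_sub_le (hα₀ : 0 ≤ α) (hα₁ : α < 1) (h' : d' ∈ linCone x α z) (t : Fin 3) :
    l2 (d.s t - d'.s t) ≤ l1 (linS α z d t) + l2 (d.w t - d'.w t) := by
  have h : d.s t - d'.s t = linS α z d t +
      fun i => dsigma α (z.w t i) (d.w t i) - dsigma α (z.w t i) (d'.w t i) := by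
    funext i
    have := congrFun (h' t).2.1 i
    simp only [linS, Pi.zero_apply, Pi.sub_apply, Pi.add_apply] at this ⊢
    linarith
  rw [h]
  exact (l2_add_le _ _).trans (add_le_add (l2_le_l1 _)
    (l2_le_of_abs_le fun i => abs_dsigma_sub_le (by linarith) hα₁ _ _ _))

theorem l2_r_sub_le (hα₀ : 0 ≤ α) (hα₁ : α < 1) (h' : d' ∈ linCone x α z) (t : Fin 3) :
    l2 (d.r t - d'.r t) ≤ l1 (linR α z d t) + l2 (d.v t - d'.v t) := by
  have h : d.r t - d'.r t = linR α z d t +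
      fun i => dsigma α (z.v t i) (d.v t i) - dsigma α (z.v t i) (d'.v t i) := by
    funext i
    have := congrFun (h' t).2.2.2 i
    simp only [linR, Pi.zero_apply, Pi.sub_apply, Pi.add_apply] at this ⊢
    linarith
  rw [h]
  exact (l2_add_le _ _).trans (add_le_add (l2_le_l1 _)
    (l2_le_of_abs_le fun i => abs_dsigma_sub_le (by linarith) hα₁ _ _ _))

/-- An error made at one time step is amplified by at most `‖W‖` at each of the later ones. -/
theorem sum_l2_s_sub_le (hα₀ : 0 ≤ α) (hα₁ : α < 1) (hθ : ∀ i, d (.inl i) = d' (.inl i))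
    (h' : d' ∈ linCone x α z) {ω : ℝ} (hω : √(paramNormSq z) ≤ ω) :
    ∑ t, l2 (d.s t - d'.s t) ≤
      (∑ i ∈ Finset.range 3, ω ^ i) * ∑ t, (l1 (linW x z d t) + l1 (linS α z d t)) := by
  have hω0 : 0 ≤ ω := (Real.sqrt_nonneg _).trans hω
  have step (t : Fin 3) : l2 (d.s t - d'.s t) ≤
      l1 (linW x z d t) + l1 (linS α z d t) + ω * l2 (d.sPrev t - d'.sPrev t) := by
    have h1 := l2_s_sub_le (d := d) hα₀ hα₁ h' t
    have h2 := l2_w_sub_le hθ h' t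
    have h3 := mul_le_mul_of_nonneg_right hω (l2_nonneg (d.sPrev t - d'.sPrev t))
    linarith
  have h0 := step 0
  have h1 := step 1
  have h2 := step 2
  have e0 : d.sPrev 0 - d'.sPrev 0 = 0 := sub_self (0 : Fin N₁ → ℝ)
  have e1 : d.sPrev 1 - d'.sPrev 1 = d.s 0 - d'.s 0 := rfl
  have e2 : d.sPrev 2 - d'.sPrev 2 = d.s 1 - d'.s 1 := rfl
  rw [e0, l2_zero, mul_zero, add_zero] at h0
  rw [e1] at h1
  rw [e2] at h2
  have p (t : Fin 3) : 0 ≤ l1 (linW x z d t) + l1 (linS α z d t) :=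
    add_nonneg (l1_nonneg _) (l1_nonneg _)
  have p1 := p 1
  have p2 := p 2
  simp only [Fin.sum_univ_three, Finset.sum_range_succ, Finset.sum_range_zero] at *
  generalize l1 (linW x z d 0) + l1 (linS α z d 0) = q0 at *
  generalize l1 (linW x z d 1) + l1 (linS α z d 1) = q1 at *
  generalize l1 (linW x z d 2) + l1 (linS α z d 2) = q2 at *
  have m1 := mul_le_mul_of_nonneg_left h0 hω0
  have m2 := mul_le_mul_of_nonneg_left h1 hω0
  have m3 := mul_le_mul_of_nonneg_left m1 hω0
  have n1 := mul_nonneg hω0 p1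
  have n2 := mul_nonneg hω0 p2
  have n3 := mul_nonneg hω0 n1
  have n4 := mul_nonneg hω0 n2
  nlinarith

theorem inner_gradF_sub (y : Fin 3 → Fin N₂ → ℝ) (lam : ℝ)
    (hθ : ∀ i, d (.inl i) = d' (.inl i)) :
    inner ℝ (gradF y lam z) d - inner ℝ (gradF y lam z) d' =
      ∑ t, (z.r t - y t) ⬝ᵥ (d.r t - d'.r t) / 3 := by
  rw [← inner_sub_right]
  simp only [PiLp.inner_apply, RCLike.inner_apply, conj_trivial, gradF, PiLp.sub_apply,
    Fintype.sum_sum_type, hθ, sub_self, zero_mul, Finset.sum_const_zero, weight, Sum.elim_inr, Sum.elim_inl,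
    center, Pi.zero_apply, mul_zero, zero_add, Fintype.sum_prod_type, dotProduct, Pi.sub_apply,
    Point.r, Finset.sum_div]
  exact Finset.sum_congr rfl fun t _ => Finset.sum_congr rfl fun i _ => by ring

/-- If `d` and `d'` have the same parameter part and `d'` solves the linearized network equations,
then the derivatives of `F` along `d` and `d'` differ by at most the threshold values times the
`ℓ₁`-norms of the linearized residuals of `d`. -/
theorem abs_inner_gradF_sub_le {y : Fin 3 → Fin N₂ → ℝ} {lam : ℝ} (hα₀ : 0 ≤ α) (hα₁ : α < 1)
    (hlam : 0 < lam) (hF : F y lam z ≤ gammaY y) (hθ : ∀ i, d (.inl i) = d' (.inl i))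
    (h' : d' ∈ linCone x α z) :
    |inner ℝ (gradF y lam z) d - inner ℝ (gradF y lam z) d'| ≤
      gammaOne y lam * gammaY y * √(2 / (3 * lam)) *
        ∑ t, (l1 (linW x z d t) + l1 (linS α z d t)) +
      √(2 * gammaY y / 3) * ∑ t, (l1 (linV z d t) + l1 (linR α z d t)) := by
  set ρ := √(2 * gammaY y / 3) with hρ
  set ω := √(gammaY y / lam) with hω_def
  have hρ0 : 0 ≤ ρ := Real.sqrt_nonneg _
  have hω0 : 0 ≤ ω := Real.sqrt_nonneg _
  have hG : 0 ≤ gammaY y := by unfold gammaY; positivity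
  have hω : √(paramNormSq z) ≤ ω := Real.sqrt_le_sqrt (paramNormSq_le hlam hF)
  -- The first threshold is the output threshold `ρ`, times the bound `ω` on `‖V‖`, times the
  -- amplification `1 + ω + ω²` of hidden errors through the recurrence.
  have hthr : gammaOne y lam * gammaY y * √(2 / (3 * lam)) = ρ * (ω * gammaOne y lam) := by
    have : ρ * ω = gammaY y * √(2 / (3 * lam)) := by
      rw [hρ, hω_def, ← Real.sqrt_mul (by positivity),
        show 2 * gammaY y / 3 * (gammaY y / lam) = gammaY y ^ 2 * (2 / (3 * lam)) by
          field_simp, Real.sqrt_mul (by positivity), Real.sqrt_sq hG]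
    rw [mul_assoc, ← this]; ring
  have hr (t : Fin 3) : l2 (d.r t - d'.r t) ≤
      (l1 (linV z d t) + l1 (linR α z d t)) + ω * l2 (d.s t - d'.s t) := by
    have h1 := l2_r_sub_le (d := d) hα₀ hα₁ h' t
    have h2 := l2_v_sub_le hθ h' t
    have h3 := mul_le_mul_of_nonneg_right hω (l2_nonneg (d.s t - d'.s t))
    linarith
  rw [inner_gradF_sub y lam hθ, hthr]
  calc |∑ t, (z.r t - y t) ⬝ᵥ (d.r t - d'.r t) / 3|
      ≤ ∑ t, |(z.r t - y t) ⬝ᵥ (d.r t - d'.r t) / 3| := Finset.abs_sum_le_sum_abs _ _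
    _ ≤ ∑ t, ρ * ((l1 (linV z d t) + l1 (linR α z d t)) + ω * l2 (d.s t - d'.s t)) := by
        refine Finset.sum_le_sum fun t _ => ?_
        rw [abs_div, abs_of_pos (by norm_num : (0 : ℝ) < 3)]
        calc _ ≤ l2 (z.r t - y t) * l2 (d.r t - d'.r t) / 3 :=
              div_le_div_of_nonneg_right (abs_dotProduct_le_l2 _ _) (by norm_num)
          _ = l2 (z.r t - y t) / 3 * l2 (d.r t - d'.r t) := by ring
          _ ≤ _ := mul_le_mul (l2_output_sub_le hlam hF t) (hr t) (l2_nonneg _) hρ0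
    _ = ρ * (ω * ∑ t, l2 (d.s t - d'.s t)) +
          ρ * ∑ t, (l1 (linV z d t) + l1 (linR α z d t)) := by
        rw [← Finset.mul_sum, Finset.sum_add_distrib, ← Finset.mul_sum]; ring
    _ ≤ ρ * (ω * (gammaOne y lam * ∑ t, (l1 (linW x z d t) + l1 (linS α z d t)))) +
          ρ * ∑ t, (l1 (linV z d t) + l1 (linR α z d t)) := by
        gcongr
        exact sum_l2_s_sub_le hα₀ hα₁ hθ h' hω
    _ = _ := by ring

end Sensitivity

end RNN

/-! ### Unrolling the recurrence -/

namespace RNN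

variable {N₀ N₁ N₂ : ℕ}

/-- A recurrence along the three time steps has a solution with any prescribed parameter part. -/
theorem exists_unroll (θ : ParamIdx N₀ N₁ N₂ → ℝ) (W : Matrix (Fin N₁) (Fin N₁) ℝ)
    (V : Matrix (Fin N₂) (Fin N₁) ℝ) (p : Fin 3 → Fin N₁ → ℝ) (f : Fin 3 → Fin N₁ → ℝ → ℝ)
    (g : Fin 3 → Fin N₂ → ℝ) (h : Fin 3 → Fin N₂ → ℝ → ℝ) :
    ∃ d : Point N₀ N₁ N₂, (∀ i, d (.inl i) = θ i) ∧ ∀ t,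
      d.w t = W *ᵥ d.sPrev t + p t ∧ (∀ i, d.s t i = f t i (d.w t i)) ∧
      d.v t = V *ᵥ d.s t + g t ∧ ∀ i, d.r t i = h t i (d.v t i) := by
  let w₀ : Fin N₁ → ℝ := W *ᵥ 0 + p 0
  let s₀ : Fin N₁ → ℝ := fun i => f 0 i (w₀ i)
  let w₁ : Fin N₁ → ℝ := W *ᵥ s₀ + p 1
  let s₁ : Fin N₁ → ℝ := fun i => f 1 i (w₁ i)
  let w₂ : Fin N₁ → ℝ := W *ᵥ s₁ + p 2
  let s₂ : Fin N₁ → ℝ := fun i => f 2 i (w₂ i)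
  let w : Fin 3 → Fin N₁ → ℝ := ![w₀, w₁, w₂]
  let s : Fin 3 → Fin N₁ → ℝ := ![s₀, s₁, s₂]
  let v : Fin 3 → Fin N₂ → ℝ := fun t => V *ᵥ s t + g t
  refine ⟨WithLp.toLp 2 (Sum.elim θ (Sum.elim (fun j => w j.1 j.2) (Sum.elim (fun j => s j.1 j.2)
    (Sum.elim (fun j => v j.1 j.2) fun j => h j.1 j.2 (v j.1 j.2))))), fun i => rfl, fun t => ?_⟩
  fin_cases t <;> exact ⟨rfl, fun i => rfl, rfl, fun i => rfl⟩

theorem exists_mem_feasible (x : Fin 3 → Fin N₀ → ℝ) (α : ℝ) (θ : Point N₀ N₁ N₂) :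
    ∃ z ∈ (feasible x α : Set (Point N₀ N₁ N₂)), ∀ i, z (.inl i) = θ (.inl i) := by
  obtain ⟨z, hθ, hz⟩ := exists_unroll (fun i => θ (.inl i)) θ.W θ.V
    (fun t => θ.A *ᵥ x t + θ.b) (fun _ _ => sigma α) (fun _ => θ.c) (fun _ _ => sigma α)
  have hA : z.A = θ.A := by ext i j; exact hθ _
  have hV : z.V = θ.V := by ext i j; exact hθ _
  have hW : z.W = θ.W := by ext i j; exact hθ _
  have hb : z.b = θ.b := by ext i; exact hθ _
  have hc : z.c = θ.c := by ext i; exact hθ _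
  refine ⟨z, fun t => ?_, hθ⟩
  rw [hA, hV, hW, hb, hc, add_assoc]
  exact hz t

/-- The linearized residuals of a direction with given parameter part can be prescribed. -/
theorem exists_lin_eq (x : Fin 3 → Fin N₀ → ℝ) (α : ℝ) (z θ : Point N₀ N₁ N₂)
    (eW eS : Fin 3 → Fin N₁ → ℝ) (eV eR : Fin 3 → Fin N₂ → ℝ) :
    ∃ d : Point N₀ N₁ N₂, (∀ i, d (.inl i) = θ (.inl i)) ∧ ∀ t,
      linW x z d t = eW t ∧ linS α z d t = eS t ∧ linV z d t = eV t ∧ linR α z d t = eR t := by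
  obtain ⟨d, hθ, hd⟩ := exists_unroll (fun i => θ (.inl i)) z.W z.V
    (fun t => eW t + θ.W *ᵥ z.sPrev t + θ.A *ᵥ x t + θ.b)
    (fun t i u => eS t i + dsigma α (z.w t i) u)
    (fun t => eV t + θ.V *ᵥ z.s t + θ.c) (fun t i u => eR t i + dsigma α (z.v t i) u)
  have hA : d.A = θ.A := by ext i j; exact hθ _
  have hV : d.V = θ.V := by ext i j; exact hθ _
  have hW : d.W = θ.W := by ext i j; exact hθ _
  have hb : d.b = θ.b := by ext i; exact hθ _
  have hc : d.c = θ.c := by ext i; exact hθ _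
  refine ⟨d, hθ, fun t => ?_⟩
  obtain ⟨h1, h2, h3, h4⟩ := hd t
  refine ⟨?_, ?_, ?_, ?_⟩
  · rw [linW, h1, hA, hW, hb]; abel
  · funext i; rw [linS, h2]; ring
  · rw [linV, h3, hV, hc]; abel
  · funext i; rw [linR, h4]; ring

theorem zero_mem_linCone (x : Fin 3 → Fin N₀ → ℝ) (α : ℝ) (z : Point N₀ N₁ N₂) :
    (0 : Point N₀ N₁ N₂) ∈ linCone x α z := by
  have h0 (t : Fin 3) : (0 : Point N₀ N₁ N₂).sPrev t = 0 := by fin_cases t <;> rfl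
  have hA : (0 : Point N₀ N₁ N₂).A = 0 := rfl
  have hV : (0 : Point N₀ N₁ N₂).V = 0 := rfl
  have hW : (0 : Point N₀ N₁ N₂).W = 0 := rfl
  have hb : (0 : Point N₀ N₁ N₂).b = 0 := rfl
  have hc : (0 : Point N₀ N₁ N₂).c = 0 := rfl
  have hw (t) : (0 : Point N₀ N₁ N₂).w t = 0 := rfl
  have hs (t) : (0 : Point N₀ N₁ N₂).s t = 0 := rfl
  have hv (t) : (0 : Point N₀ N₁ N₂).v t = 0 := rfl
  have hr (t) : (0 : Point N₀ N₁ N₂).r t = 0 := rfl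
  intro t
  refine ⟨?_, ?_, ?_, ?_⟩
  · simp [linW, h0, hA, hW, hb, hw]
  · funext i; simp [linS, hs, hw, dsigma_zero_right]
  · simp [linV, hV, hc, hv, hs]
  · funext i; simp [linR, hr, hv, dsigma_zero_right]

theorem zero_mem_feasible (x : Fin 3 → Fin N₀ → ℝ) (α : ℝ) :
    (0 : Point N₀ N₁ N₂) ∈ feasible x α := by
  have h0 (t : Fin 3) : (0 : Point N₀ N₁ N₂).sPrev t = 0 := by fin_cases t <;> rfl
  have hA : (0 : Point N₀ N₁ N₂).A = 0 := rfl
  have hb : (0 : Point N₀ N₁ N₂).b = 0 := rfl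
  have hc : (0 : Point N₀ N₁ N₂).c = 0 := rfl
  have hw (t) : (0 : Point N₀ N₁ N₂).w t = 0 := rfl
  have hs (t) : (0 : Point N₀ N₁ N₂).s t = 0 := rfl
  have hv (t) : (0 : Point N₀ N₁ N₂).v t = 0 := rfl
  have hr (t) : (0 : Point N₀ N₁ N₂).r t = 0 := rfl
  intro t
  simp [h0, hA, hb, hc, hw, hs, hv, hr, sigma_zero]

/-! ### Tangent and radial cones of the feasible set -/

section SeqDeriv

variable {E : Type*} [AddCommGroup E] [Module ℝ E] [TopologicalSpace E]

/-- The sequence `f` tends to `a`, and its difference quotients with step sizes `τ` tend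
to `l`. -/
def HasSeqDeriv (τ : ℕ → ℝ) (f : ℕ → E) (a l : E) : Prop :=
  Tendsto f atTop (𝓝 a) ∧ Tendsto (fun k => (τ k)⁻¹ • (f k - a)) atTop (𝓝 l)

variable {τ : ℕ → ℝ}

theorem HasSeqDeriv.add [ContinuousAdd E] {f g : ℕ → E} {a b l m : E} (hf : HasSeqDeriv τ f a l)
    (hg : HasSeqDeriv τ g b m) : HasSeqDeriv τ (fun k => f k + g k) (a + b) (l + m) :=
  ⟨hf.1.add hg.1, (hf.2.add hg.2).congr fun k => by module⟩

theorem hasSeqDeriv_const (a : E) : HasSeqDeriv τ (fun _ => a) a 0 :=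
  ⟨tendsto_const_nhds, by simpa using tendsto_const_nhds⟩

theorem HasSeqDeriv.unique [T2Space E] {f : ℕ → E} {a l m : E} (hf : HasSeqDeriv τ f a l)
    (hg : HasSeqDeriv τ f a m) : l = m :=
  tendsto_nhds_unique hf.2 hg.2

theorem hasSeqDeriv_add_smul [ContinuousAdd E] [ContinuousSMul ℝ E] (hτ : ∀ k, 0 < τ k)
    (hτ0 : Tendsto τ atTop (𝓝 0)) (a l : E) : HasSeqDeriv τ (fun k => a + τ k • l) a l := by
  refine ⟨by simpa using tendsto_const_nhds.add (hτ0.smul_const l), ?_⟩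
  refine tendsto_const_nhds.congr fun k => ?_
  rw [add_sub_cancel_left, smul_smul, inv_mul_cancel₀ (hτ k).ne', one_smul]

theorem hasSeqDeriv_pi {ι : Type*} {f : ℕ → ι → ℝ} {a l : ι → ℝ} :
    HasSeqDeriv τ f a l ↔ ∀ i, HasSeqDeriv τ (fun k => f k i) (a i) (l i) := by
  simp only [HasSeqDeriv, tendsto_pi_nhds, forall_and]
  rfl

theorem hasSeqDeriv_matrix {M N : ℕ} {f : ℕ → Matrix (Fin M) (Fin N) ℝ}
    {a l : Matrix (Fin M) (Fin N) ℝ} :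
    HasSeqDeriv τ f a l ↔ ∀ i j, HasSeqDeriv τ (fun k => f k i j) (a i j) (l i j) := by
  have key (g : ℕ → Matrix (Fin M) (Fin N) ℝ) (b : Matrix (Fin M) (Fin N) ℝ) :
      Tendsto g atTop (𝓝 b) ↔ ∀ i j, Tendsto (fun k => g k i j) atTop (𝓝 (b i j)) :=
    tendsto_pi_nhds.trans (forall_congr' fun _ => tendsto_pi_nhds)
  simp only [HasSeqDeriv, key, forall_and]
  rfl

theorem HasSeqDeriv.mulVec {M N : ℕ} {B : ℕ → Matrix (Fin M) (Fin N) ℝ}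
    {B₀ B' : Matrix (Fin M) (Fin N) ℝ} {f : ℕ → Fin N → ℝ} {a l : Fin N → ℝ}
    (hB : HasSeqDeriv τ B B₀ B') (hf : HasSeqDeriv τ f a l) :
    HasSeqDeriv τ (fun k => B k *ᵥ f k) (B₀ *ᵥ a) (B' *ᵥ a + B₀ *ᵥ l) := by
  have hc : Continuous fun q : Matrix (Fin M) (Fin N) ℝ × (Fin N → ℝ) => q.1 *ᵥ q.2 :=
    Continuous.matrix_mulVec continuous_fst continuous_snd
  have lim {P : ℕ → Matrix (Fin M) (Fin N) ℝ} {P₀ : Matrix (Fin M) (Fin N) ℝ} {g : ℕ → Fin N → ℝ}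
      {g₀ : Fin N → ℝ} (hP : Tendsto P atTop (𝓝 P₀)) (hg : Tendsto g atTop (𝓝 g₀)) :
      Tendsto (fun k => P k *ᵥ g k) atTop (𝓝 (P₀ *ᵥ g₀)) :=
    (hc.tendsto (P₀, g₀)).comp (hP.prodMk_nhds hg)
  refine ⟨lim hB.1 hf.1, ((lim hB.2 hf.1).add (lim tendsto_const_nhds hf.2)).congr fun k => ?_⟩
  rw [Matrix.smul_mulVec, Matrix.mulVec_smul, Matrix.sub_mulVec, Matrix.mulVec_sub]
  module

/-- `sigma α` is Hadamard directionally differentiable. -/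
theorem HasSeqDeriv.sigma {α : ℝ} (hα₀ : 0 ≤ α) (hα₁ : α < 1) (hτ : ∀ k, 0 < τ k)
    (hτ0 : Tendsto τ atTop (𝓝 0)) {f : ℕ → ℝ} {a l : ℝ} (hf : HasSeqDeriv τ f a l) :
    HasSeqDeriv τ (fun k => RNN.sigma α (f k)) (RNN.sigma α a) (dsigma α a l) := by
  have hα' : -1 ≤ α := by linarith
  refine ⟨((lipschitzWith_sigma hα' hα₁).continuous.tendsto a).comp hf.1, ?_⟩
  -- The Lipschitz bound reduces the claim to the exact ray `a + τ l`.
  have hdiff : Tendsto (fun k => (τ k)⁻¹ • (RNN.sigma α (f k) - RNN.sigma α (a + τ k * l))) atTop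
      (𝓝 0) := by
    have hlim : Tendsto (fun k => |(τ k)⁻¹ • (f k - a) - l|) atTop (𝓝 0) := by
      simpa using (hf.2.sub_const l).abs
    refine squeeze_zero_norm (fun k => ?_) hlim
    have e : (τ k)⁻¹ • (f k - a) - l = (τ k)⁻¹ * (f k - (a + τ k * l)) := by
      have := (hτ k).ne'
      simp only [smul_eq_mul]; field_simp; ring
    rw [e, Real.norm_eq_abs, smul_eq_mul, abs_mul, abs_mul]
    exact mul_le_mul_of_nonneg_left (abs_sigma_sub_le hα' hα₁ _ _) (abs_nonneg _)
  have hτ' : Tendsto τ atTop (𝓝[>] 0) :=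
    tendsto_nhdsWithin_iff.2 ⟨hτ0, Eventually.of_forall hτ⟩
  have hsum := hdiff.add (tendsto_const_nhds (x := dsigma α a l))
  rw [zero_add] at hsum
  refine hsum.congr' ?_
  filter_upwards [hτ'.eventually (eventually_sigma_add_mul hα₁ a l)] with k hk
  have := (hτ k).ne'
  rw [hk]
  simp only [smul_eq_mul]; field_simp; ring

theorem hasSeqDeriv_point_iff {p : ℕ → Point N₀ N₁ N₂} {z d : Point N₀ N₁ N₂} :
    HasSeqDeriv τ p z d ↔ ∀ i, HasSeqDeriv τ (fun k => p k i) (z i) (d i) := by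
  have key (f : ℕ → Point N₀ N₁ N₂) (a : Point N₀ N₁ N₂) :
      Tendsto f atTop (𝓝 a) ↔ ∀ i, Tendsto (fun k => f k i) atTop (𝓝 (a i)) := by
    rw [← tendsto_pi_nhds]
    exact ((PiLp.homeomorph 2 fun _ => ℝ).isInducing.tendsto_nhds_iff :
      Tendsto f atTop (𝓝 a) ↔ _)
  simp only [HasSeqDeriv, key, forall_and]
  rfl

variable {x : Fin 3 → Fin N₀ → ℝ} {α : ℝ} {p : ℕ → Point N₀ N₁ N₂} {z d : Point N₀ N₁ N₂}

theorem hasSeqDeriv_w (hp : ∀ k, p k ∈ feasible x α) (hz : z ∈ feasible x α)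
    (hθ : ∀ i, HasSeqDeriv τ (fun k => p k (.inl i)) (z (.inl i)) (d (.inl i))) {t : Fin 3}
    (hs : HasSeqDeriv τ (fun k => (p k).sPrev t) (z.sPrev t) (d.sPrev t)) :
    HasSeqDeriv τ (fun k => (p k).w t) (z.w t)
      (d.W *ᵥ z.sPrev t + z.W *ᵥ d.sPrev t + d.A *ᵥ x t + d.b) := by
  have hW : HasSeqDeriv τ (fun k => (p k).W) z.W d.W :=
    hasSeqDeriv_matrix.2 fun i j => hθ _
  have hA : HasSeqDeriv τ (fun k => (p k).A) z.A d.A :=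
    hasSeqDeriv_matrix.2 fun i j => hθ _
  have hb : HasSeqDeriv τ (fun k => (p k).b) z.b d.b := hasSeqDeriv_pi.2 fun i => hθ _
  have := ((hW.mulVec hs).add (hA.mulVec (hasSeqDeriv_const (x t)))).add hb
  rw [Matrix.mulVec_zero, add_zero] at this
  simpa only [← (hp _ t).1, ← (hz t).1] using this

theorem hasSeqDeriv_v (hp : ∀ k, p k ∈ feasible x α) (hz : z ∈ feasible x α)
    (hθ : ∀ i, HasSeqDeriv τ (fun k => p k (.inl i)) (z (.inl i)) (d (.inl i))) {t : Fin 3}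
    (hs : HasSeqDeriv τ (fun k => (p k).s t) (z.s t) (d.s t)) :
    HasSeqDeriv τ (fun k => (p k).v t) (z.v t) (d.V *ᵥ z.s t + z.V *ᵥ d.s t + d.c) := by
  have hV : HasSeqDeriv τ (fun k => (p k).V) z.V d.V :=
    hasSeqDeriv_matrix.2 fun i j => hθ _
  have hc : HasSeqDeriv τ (fun k => (p k).c) z.c d.c := hasSeqDeriv_pi.2 fun i => hθ _
  simpa only [← (hp _ t).2.2.1, ← (hz t).2.2.1] using (hV.mulVec hs).add hc

theorem hasSeqDeriv_s (hα₀ : 0 ≤ α) (hα₁ : α < 1) (hτ : ∀ k, 0 < τ k)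
    (hτ0 : Tendsto τ atTop (𝓝 0)) (hp : ∀ k, p k ∈ feasible x α) (hz : z ∈ feasible x α)
    {t : Fin 3} {l : Fin N₁ → ℝ} (hw : HasSeqDeriv τ (fun k => (p k).w t) (z.w t) l) :
    HasSeqDeriv τ (fun k => (p k).s t) (z.s t) (fun i => dsigma α (z.w t i) (l i)) := by
  refine hasSeqDeriv_pi.2 fun i => ?_
  simpa only [← (hp _ t).2.1, ← (hz t).2.1] using
    (hasSeqDeriv_pi.1 hw i).sigma hα₀ hα₁ hτ hτ0

theorem hasSeqDeriv_r (hα₀ : 0 ≤ α) (hα₁ : α < 1) (hτ : ∀ k, 0 < τ k)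
    (hτ0 : Tendsto τ atTop (𝓝 0)) (hp : ∀ k, p k ∈ feasible x α) (hz : z ∈ feasible x α)
    {t : Fin 3} {l : Fin N₂ → ℝ} (hv : HasSeqDeriv τ (fun k => (p k).v t) (z.v t) l) :
    HasSeqDeriv τ (fun k => (p k).r t) (z.r t) (fun i => dsigma α (z.v t i) (l i)) := by
  refine hasSeqDeriv_pi.2 fun i => ?_
  simpa only [← (hp _ t).2.2.2, ← (hz t).2.2.2] using
    (hasSeqDeriv_pi.1 hv i).sigma hα₀ hα₁ hτ hτ0

theorem hasSeqDeriv_sPrev {f : ℕ → Point N₀ N₁ N₂} {a l : Point N₀ N₁ N₂} (t : Fin 3)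
    (h : ∀ t' < t, HasSeqDeriv τ (fun k => (f k).s t') (a.s t') (l.s t')) :
    HasSeqDeriv τ (fun k => (f k).sPrev t) (a.sPrev t) (l.sPrev t) := by
  fin_cases t
  · exact hasSeqDeriv_const 0
  · exact h 0 (by decide)
  · exact h 1 (by decide)

theorem mem_linCone_iff : d ∈ linCone x α z ↔ ∀ t,
    d.w t = d.W *ᵥ z.sPrev t + z.W *ᵥ d.sPrev t + d.A *ᵥ x t + d.b ∧
    (d.s t = fun i => dsigma α (z.w t i) (d.w t i)) ∧
    d.v t = d.V *ᵥ z.s t + z.V *ᵥ d.s t + d.c ∧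
    d.r t = fun i => dsigma α (z.v t i) (d.v t i) := by
  have e {N : ℕ} (a b : Fin N → ℝ) : (fun i => a i - b i) = 0 ↔ a = b :=
    sub_eq_zero (a := a) (b := b)
  simp only [linCone, Set.mem_ofPred_eq, linW, linV, sub_eq_zero]
  refine forall_congr' fun t => and_congr_right' (and_congr ?_ (and_congr_right' ?_))
  · exact e _ _
  · exact e _ _

/-- The tangent cone is cut out by the linearized network equations: difference quotients of
feasible points satisfy these equations in the limit, and conversely the feasible points with
parameters `θ + τ d_θ` realize every solution as a tangent direction. -/
theorem bouligandCone_feasible (hα₀ : 0 ≤ α) (hα₁ : α < 1) (hz : z ∈ feasible x α) :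
    bouligandCone (feasible x α) z = linCone x α z := by
  ext d
  rw [mem_linCone_iff]
  constructor
  · rintro ⟨p, τ, hp, hpz, hτ, hτ0, hd⟩
    have h : ∀ i, HasSeqDeriv τ (fun k => p k i) (z i) (d i) :=
      hasSeqDeriv_point_iff.1 ⟨hpz, hd⟩
    intro t
    have hw : HasSeqDeriv τ (fun k => (p k).w t) (z.w t) (d.w t) :=
      hasSeqDeriv_pi.2 fun i => h _
    have hs (t) : HasSeqDeriv τ (fun k => (p k).s t) (z.s t) (d.s t) :=
      hasSeqDeriv_pi.2 fun i => h _
    have hv : HasSeqDeriv τ (fun k => (p k).v t) (z.v t) (d.v t) :=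
      hasSeqDeriv_pi.2 fun i => h _
    have hr : HasSeqDeriv τ (fun k => (p k).r t) (z.r t) (d.r t) :=
      hasSeqDeriv_pi.2 fun i => h _
    exact ⟨hw.unique (hasSeqDeriv_w hp hz (fun i => h _)
        (hasSeqDeriv_sPrev t fun t' _ => hs t')),
      (hs t).unique (hasSeqDeriv_s hα₀ hα₁ hτ hτ0 hp hz hw),
      hv.unique (hasSeqDeriv_v hp hz (fun i => h _) (hs t)),
      hr.unique (hasSeqDeriv_r hα₀ hα₁ hτ hτ0 hp hz hv)⟩
  · intro hd
    let τ : ℕ → ℝ := fun k => 1 / ((k : ℝ) + 1)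
    have hτ (k : ℕ) : 0 < τ k := by simp only [τ]; positivity
    have hτ0 : Tendsto τ atTop (𝓝 0) := tendsto_one_div_add_atTop_nhds_zero_nat
    choose p hp hpθ using fun k : ℕ => exists_mem_feasible x α (z + τ k • d)
    have hθ (i) : HasSeqDeriv τ (fun k => p k (.inl i)) (z (.inl i)) (d (.inl i)) := by
      simp only [hpθ]
      exact hasSeqDeriv_add_smul hτ hτ0 _ _
    have step (t) (h : ∀ t' < t, HasSeqDeriv τ (fun k => (p k).s t') (z.s t') (d.s t')) :
        HasSeqDeriv τ (fun k => (p k).w t) (z.w t) (d.w t) ∧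
        HasSeqDeriv τ (fun k => (p k).s t) (z.s t) (d.s t) := by
      have hw := hasSeqDeriv_w hp hz hθ (hasSeqDeriv_sPrev t h)
      rw [← (hd t).1] at hw
      have hs := hasSeqDeriv_s hα₀ hα₁ hτ hτ0 hp hz hw
      rw [← (hd t).2.1] at hs
      exact ⟨hw, hs⟩
    have hws (t : Fin 3) : HasSeqDeriv τ (fun k => (p k).w t) (z.w t) (d.w t) ∧
        HasSeqDeriv τ (fun k => (p k).s t) (z.s t) (d.s t) := by
      induction t using WellFoundedLT.induction with
      | ind t ih => exact step t fun t' ht' => (ih t' ht').2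
    have hv (t : Fin 3) : HasSeqDeriv τ (fun k => (p k).v t) (z.v t) (d.v t) := by
      have := hasSeqDeriv_v hp hz hθ (hws t).2
      rwa [← (hd t).2.2.1] at this
    have hr (t : Fin 3) : HasSeqDeriv τ (fun k => (p k).r t) (z.r t) (d.r t) := by
      have := hasSeqDeriv_r hα₀ hα₁ hτ hτ0 hp hz (hv t)
      rwa [← (hd t).2.2.2] at this
    have hlim : HasSeqDeriv τ p z d := by
      refine hasSeqDeriv_point_iff.2 ?_
      rintro (i | ⟨t, i⟩ | ⟨t, i⟩ | ⟨t, i⟩ | ⟨t, i⟩)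
      · exact hθ i
      · exact hasSeqDeriv_pi.1 (hws t).1 i
      · exact hasSeqDeriv_pi.1 (hws t).2 i
      · exact hasSeqDeriv_pi.1 (hv t) i
      · exact hasSeqDeriv_pi.1 (hr t) i
    exact ⟨p, τ, hp, hlim.1, hτ, hτ0, hlim.2⟩

/-- Along a tangent direction the only residuals that do not vanish for small steps are the
second-order terms `τ² D_W d_s` and `τ² D_V d_s`. -/
theorem radialCone_feasible (hα₀ : 0 ≤ α) (hα₁ : α < 1) (hz : z ∈ feasible x α) :
    radialCone (feasible x α) z =
      {d | d ∈ bouligandCone (feasible x α) z ∧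
        ∀ t : Fin 3, d.V *ᵥ d.s t = 0 ∧ d.W *ᵥ d.sPrev t = 0} := by
  ext d
  have hz' := mem_feasible_iff.1 hz
  constructor
  · intro hd
    have hT := radialCone_subset_bouligandCone _ _ hd
    refine ⟨hT, fun t => ?_⟩
    rw [bouligandCone_feasible hα₀ hα₁ hz] at hT
    obtain ⟨τ, hτ, -, hS⟩ := hd
    have hne : τ 0 ^ 2 ≠ 0 := (pow_pos (hτ 0) 2).ne'
    have h := mem_feasible_iff.1 (hS 0) t
    have hW := h.1
    have hV := h.2.2.1
    rw [resW_add_smul, (hz' t).1, (hT t).1, smul_zero, add_zero, zero_add,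
      smul_eq_zero_iff_right hne, neg_eq_zero] at hW
    rw [resV_add_smul, (hz' t).2.2.1, (hT t).2.2.1, smul_zero, add_zero, zero_add,
      smul_eq_zero_iff_right hne, neg_eq_zero] at hV
    exact ⟨hV, hW⟩
  · rintro ⟨hT, h0⟩
    rw [bouligandCone_feasible hα₀ hα₁ hz] at hT
    refine mem_radialCone_of_eventually ?_
    filter_upwards [eventually_all.2 fun t => eventually_resS_add_smul hα₁ z d t,
      eventually_all.2 fun t => eventually_resR_add_smul hα₁ z d t] with τ hS hR
    refine mem_feasible_iff.2 fun t => ⟨?_, ?_, ?_, ?_⟩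
    · rw [resW_add_smul, (hz' t).1, (hT t).1, (h0 t).2]; simp
    · rw [hS, (hz' t).2.1, (hT t).2.1]; simp
    · rw [resV_add_smul, (hz' t).2.2.1, (hT t).2.2.1, (h0 t).1]; simp
    · rw [hR, (hz' t).2.2.2, (hT t).2.2.2]; simp

end SeqDeriv

end RNN

/-! ### Exactness of the penalty -/

namespace RNN

variable {N₀ N₁ N₂ : ℕ} {x : Fin 3 → Fin N₀ → ℝ} {y : Fin 3 → Fin N₂ → ℝ} {α lam β₁ β₂ : ℝ}
  {z : Point N₀ N₁ N₂}

theorem penaltyW_nonneg (z : Point N₀ N₁ N₂) :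
    0 ≤ ∑ t, (l1 (resW x z t) + l1 (resS α z t)) :=
  Finset.sum_nonneg fun _ _ => add_nonneg (l1_nonneg _) (l1_nonneg _)

theorem penaltyV_nonneg (z : Point N₀ N₁ N₂) :
    0 ≤ ∑ t, (l1 (resV z t) + l1 (resR α z t)) :=
  Finset.sum_nonneg fun _ _ => add_nonneg (l1_nonneg _) (l1_nonneg _)

theorem F_le_Theta (hβ₁ : 0 < β₁) (hβ₂ : 0 < β₂) (z : Point N₀ N₁ N₂) :
    F y lam z ≤ Theta x y α lam β₁ β₂ z := by
  have h1 := mul_nonneg hβ₁.le (penaltyW_nonneg (x := x) (α := α) z)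
  have h2 := mul_nonneg hβ₂.le (penaltyV_nonneg (α := α) z)
  rw [Theta_eq]
  linarith

theorem Theta_eq_F (hz : z ∈ feasible x α) : Theta x y α lam β₁ β₂ z = F y lam z := by
  have h := mem_feasible_iff.1 hz
  have h0 {N : ℕ} : l1 (0 : Fin N → ℝ) = 0 := l1_eq_zero.2 rfl
  simp [Theta_eq, h, h0]

theorem F_zero : F y lam (0 : Point N₀ N₁ N₂) = gammaY y := by
  simp [F, gammaY, paramNormSq, Point.A, Point.V, Point.W, Point.b, Point.c, Point.r]

theorem Theta_zero : Theta x y α lam β₁ β₂ (0 : Point N₀ N₁ N₂) = gammaY y :=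
  (Theta_eq_F (zero_mem_feasible x α)).trans F_zero

theorem dTheta_of_mem_feasible (hz : z ∈ feasible x α) (d : Point N₀ N₁ N₂) :
    dTheta x y α lam β₁ β₂ z d = inner ℝ (gradF y lam z) d +
      β₁ * ∑ t, (l1 (linW x z d t) + l1 (linS α z d t)) +
      β₂ * ∑ t, (l1 (linV z d t) + l1 (linR α z d t)) := by
  have h := mem_feasible_iff.1 hz
  simp [dTheta, h, dl1_zero_left]

/-- The direction with vanishing parameter part that shrinks all residuals at unit relative rate is
a descent direction at any infeasible point with `F ≤ γ_y`, because the penalty decreases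
faster than `F` can increase. -/
theorem mem_feasible_of_forall_dTheta_nonneg (hα₀ : 0 ≤ α) (hα₁ : α < 1) (hlam : 0 < lam)
    (hF : F y lam z ≤ gammaY y) (hβ₁ : gammaOne y lam * gammaY y * √(2 / (3 * lam)) < β₁)
    (hβ₂ : √(2 * gammaY y / 3) < β₂) (hz : ∀ d, 0 ≤ dTheta x y α lam β₁ β₂ z d) :
    z ∈ feasible x α := by
  obtain ⟨d, hθ, hd⟩ := exists_lin_eq x α z 0 (fun t => -resW x z t) (fun t => -resS α z t)
    (fun t => -resV z t) (fun t => -resR α z t)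
  have hneg {N : ℕ} (a : Fin N → ℝ) : l1 (-a) = l1 a := by simp [l1]
  have hsens := abs_inner_gradF_sub_le hα₀ hα₁ hlam hF hθ (zero_mem_linCone x α z)
  have hpos := hz d
  simp only [dTheta, hd, dl1_neg_self, ← neg_add, Finset.sum_neg_distrib, mul_neg] at hpos
  simp only [hd, hneg, inner_zero_right, sub_zero] at hsens
  have hP := penaltyW_nonneg (x := x) (α := α) z
  have hQ := penaltyV_nonneg (α := α) z
  set P := ∑ t, (l1 (resW x z t) + l1 (resS α z t)) with hP_def
  set Q := ∑ t, (l1 (resV z t) + l1 (resR α z t)) with hQ_def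
  have hle := (le_abs_self _).trans hsens
  have h1 := mul_nonneg (sub_pos.2 hβ₁).le hP
  have h2 := mul_nonneg (sub_pos.2 hβ₂).le hQ
  have hP0 : P = 0 := by
    refine (mul_eq_zero.1 (le_antisymm ?_ h1)).resolve_left (sub_pos.2 hβ₁).ne'
    linarith
  have hQ0 : Q = 0 := by
    refine (mul_eq_zero.1 (le_antisymm ?_ h2)).resolve_left (sub_pos.2 hβ₂).ne'
    linarith
  rw [hP_def, Finset.sum_eq_zero_iff_of_nonneg
    fun _ _ => add_nonneg (l1_nonneg _) (l1_nonneg _)] at hP0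
  rw [hQ_def, Finset.sum_eq_zero_iff_of_nonneg
    fun _ _ => add_nonneg (l1_nonneg _) (l1_nonneg _)] at hQ0
  refine mem_feasible_iff.2 fun t => ?_
  have hPt := (add_eq_zero_iff_of_nonneg (l1_nonneg _) (l1_nonneg _)).1 (hP0 t (Finset.mem_univ t))
  have hQt := (add_eq_zero_iff_of_nonneg (l1_nonneg _) (l1_nonneg _)).1 (hQ0 t (Finset.mem_univ t))
  exact ⟨l1_eq_zero.1 hPt.1, l1_eq_zero.1 hPt.2, l1_eq_zero.1 hQt.1, l1_eq_zero.1 hQt.2⟩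

/-- Above the thresholds the two notions of d-stationarity agree where `F ≤ γ_y`. For a
feasible point, an arbitrary direction is compared with the tangent direction that has the same
parameter part. -/
theorem isDStationary_F_iff_Theta (hα₀ : 0 ≤ α) (hα₁ : α < 1) (hlam : 0 < lam)
    (hF : F y lam z ≤ gammaY y) (hβ₁ : gammaOne y lam * gammaY y * √(2 / (3 * lam)) < β₁)
    (hβ₂ : √(2 * gammaY y / 3) < β₂) :
    IsDStationary (F y lam) (feasible x α) z ↔
      IsDStationary (Theta x y α lam β₁ β₂) Set.univ z := by
  rw [isDStationary_F_iff, isDStationary_Theta_iff hα₁]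
  constructor
  · rintro ⟨hz, hT⟩ d
    rw [bouligandCone_feasible hα₀ hα₁ hz] at hT
    obtain ⟨d', hθ, hd'⟩ := exists_lin_eq x α z d 0 0 0 0
    have hsens := abs_inner_gradF_sub_le hα₀ hα₁ hlam hF (fun i => (hθ i).symm)
      (show d' ∈ linCone x α z from hd')
    have hd0 := hT d' hd'
    rw [dTheta_of_mem_feasible hz]
    have h1 := mul_le_mul_of_nonneg_right hβ₁.le
      (Finset.sum_nonneg fun t (_ : t ∈ Finset.univ) =>
        add_nonneg (l1_nonneg (linW x z d t)) (l1_nonneg (linS α z d t)))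
    have h2 := mul_le_mul_of_nonneg_right hβ₂.le
      (Finset.sum_nonneg fun t (_ : t ∈ Finset.univ) =>
        add_nonneg (l1_nonneg (linV z d t)) (l1_nonneg (linR α z d t)))
    have h3 := (neg_le_abs _).trans hsens
    linarith
  · intro h
    have hz := mem_feasible_of_forall_dTheta_nonneg hα₀ hα₁ hlam hF hβ₁ hβ₂ h
    refine ⟨hz, fun d hd => ?_⟩
    rw [bouligandCone_feasible hα₀ hα₁ hz] at hd
    have := h d
    have h0 {N : ℕ} : l1 (0 : Fin N → ℝ) = 0 := l1_eq_zero.2 rfl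
    simpa [dTheta_of_mem_feasible hz, (hd _).1, (hd _).2.1, (hd _).2.2.1, (hd _).2.2.2, h0]
      using this

/-! ### Coercivity and existence of minimizers -/

/-- Boundedness in absolute value of a real function on a set. -/
def BoundedOn {X : Type*} (S : Set X) (f : X → ℝ) : Prop := ∃ R, ∀ z ∈ S, |f z| ≤ R

section BoundedOn

variable {X : Type*} {S : Set X} {f g : X → ℝ}

theorem BoundedOn.add (hf : BoundedOn S f) (hg : BoundedOn S g) :
    BoundedOn S fun z => f z + g z :=
  let ⟨R, hR⟩ := hf
  let ⟨R', hR'⟩ := hg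
  ⟨R + R', fun z hz => (abs_add_le _ _).trans (add_le_add (hR z hz) (hR' z hz))⟩

theorem BoundedOn.mul (hf : BoundedOn S f) (hg : BoundedOn S g) :
    BoundedOn S fun z => f z * g z := by
  obtain ⟨R, hR⟩ := hf
  obtain ⟨R', hR'⟩ := hg
  refine ⟨R * R', fun z hz => ?_⟩
  rw [abs_mul]
  exact mul_le_mul (hR z hz) (hR' z hz) (abs_nonneg _) ((abs_nonneg _).trans (hR z hz))

theorem boundedOn_const (k : ℝ) : BoundedOn S fun _ => k := ⟨|k|, fun _ _ => le_rfl⟩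

theorem BoundedOn.sigma (hα₀ : 0 ≤ α) (hα₁ : α < 1) (hf : BoundedOn S f) :
    BoundedOn S fun z => sigma α (f z) :=
  let ⟨R, hR⟩ := hf
  ⟨R, fun z hz => le_trans
    (by simpa [sigma_zero] using abs_sigma_sub_le (by linarith) hα₁ (f z) 0) (hR z hz)⟩

theorem boundedOn_sum {ι : Type*} [Fintype ι] {f : ι → X → ℝ} (h : ∀ i, BoundedOn S (f i)) :
    BoundedOn S fun z => ∑ i, f i z := by
  choose R hR using h
  exact ⟨∑ i, R i, fun z hz => (Finset.abs_sum_le_sum_abs _ _).trans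
    (Finset.sum_le_sum fun i _ => hR i z hz)⟩

theorem boundedOn_mulVec {M N : ℕ} {B : X → Matrix (Fin M) (Fin N) ℝ} {a : X → Fin N → ℝ}
    (hB : ∀ i j, BoundedOn S fun z => B z i j) (ha : ∀ j, BoundedOn S fun z => a z j)
    (i : Fin M) : BoundedOn S fun z => (B z *ᵥ a z) i :=
  boundedOn_sum fun j => (hB i j).mul (ha j)

theorem isBounded_of_boundedOn_coord {ι : Type*} [Fintype ι] {S : Set (EuclideanSpace ℝ ι)}
    (h : ∀ i, BoundedOn S fun z => z i) : Bornology.IsBounded S := by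
  obtain ⟨R, hR⟩ := boundedOn_sum fun i => (h i).mul (h i)
  refine isBounded_iff_forall_norm_le.2 ⟨√R, fun z hz => ?_⟩
  rw [EuclideanSpace.norm_eq]
  refine Real.sqrt_le_sqrt ((le_of_eq ?_).trans ((le_abs_self _).trans (hR z hz)))
  simp [sq]

end BoundedOn

theorem sum_sq_param_eq (z : Point N₀ N₁ N₂) : ∑ i, z (.inl i) ^ 2 = paramNormSq z := by
  simp [paramNormSq, Fintype.sum_sum_type, Fintype.sum_prod_type, Point.A, Point.V, Point.W,
    Point.b, Point.c]
  ring

theorem abs_le_l1 {N : ℕ} (a : Fin N → ℝ) (i : Fin N) : |a i| ≤ l1 a :=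
  Finset.single_le_sum (f := fun i => |a i|) (fun _ _ => abs_nonneg _) (Finset.mem_univ i)

/-- On a level set of the penalized objective the parameters and the residuals are bounded, hence,
by the recurrence, so are all the auxiliary variables. -/
theorem isBounded_level_Theta (hα₀ : 0 ≤ α) (hα₁ : α < 1) (hlam : 0 < lam) (hβ₁ : 0 < β₁)
    (hβ₂ : 0 < β₂) (G : ℝ) :
    Bornology.IsBounded {z : Point N₀ N₁ N₂ | Theta x y α lam β₁ β₂ z ≤ G} := by
  set S := {z : Point N₀ N₁ N₂ | Theta x y α lam β₁ β₂ z ≤ G} with hS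
  have hF {z : Point N₀ N₁ N₂} (hz : z ∈ S) : F y lam z ≤ G :=
    (F_le_Theta hβ₁ hβ₂ z).trans hz
  have hF0 (z : Point N₀ N₁ N₂) : 0 ≤ F y lam z := by
    have := mul_nonneg hlam.le (paramNormSq_nonneg z)
    unfold F; positivity
  have hparam (i) : BoundedOn S fun z => z (.inl i) := by
    refine ⟨√(G / lam), fun z hz => Real.abs_le_sqrt ?_⟩
    refine le_trans ?_ (paramNormSq_le hlam (hF hz))
    rw [← sum_sq_param_eq]
    exact Finset.single_le_sum (f := fun i => z (.inl i) ^ 2) (fun _ _ => sq_nonneg _)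
      (Finset.mem_univ i)
  have hpen1 {z : Point N₀ N₁ N₂} (hz : z ∈ S) (t : Fin 3) :
      l1 (resW x z t) + l1 (resS α z t) ≤ G / β₁ := by
    have h1 := Finset.single_le_sum (f := fun t => l1 (resW x z t) + l1 (resS α z t))
      (fun _ _ => add_nonneg (l1_nonneg _) (l1_nonneg _)) (Finset.mem_univ t)
    refine h1.trans ((le_div_iff₀' hβ₁).2 ?_)
    have h2 := mul_nonneg hβ₂.le (penaltyV_nonneg (α := α) z)
    have h3 : _ ≤ G := hz
    rw [Theta_eq] at h3
    linarith [hF0 z]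
  have hpen2 {z : Point N₀ N₁ N₂} (hz : z ∈ S) (t : Fin 3) :
      l1 (resV z t) + l1 (resR α z t) ≤ G / β₂ := by
    have h1 := Finset.single_le_sum (f := fun t => l1 (resV z t) + l1 (resR α z t))
      (fun _ _ => add_nonneg (l1_nonneg _) (l1_nonneg _)) (Finset.mem_univ t)
    refine h1.trans ((le_div_iff₀' hβ₂).2 ?_)
    have h2 := mul_nonneg hβ₁.le (penaltyW_nonneg (x := x) (α := α) z)
    have h3 : _ ≤ G := hz
    rw [Theta_eq] at h3
    linarith [hF0 z]
  have hresW (t i) : BoundedOn S fun z => resW x z t i := ⟨G / β₁, fun z hz =>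
    (abs_le_l1 _ i).trans (by linarith [hpen1 hz t, l1_nonneg (resS α z t)])⟩
  have hresS (t i) : BoundedOn S fun z => resS α z t i := ⟨G / β₁, fun z hz =>
    (abs_le_l1 _ i).trans (by linarith [hpen1 hz t, l1_nonneg (resW x z t)])⟩
  have hresV (t i) : BoundedOn S fun z => resV z t i := ⟨G / β₂, fun z hz =>
    (abs_le_l1 _ i).trans (by linarith [hpen2 hz t, l1_nonneg (resR α z t)])⟩
  have hresR (t i) : BoundedOn S fun z => resR α z t i := ⟨G / β₂, fun z hz =>
    (abs_le_l1 _ i).trans (by linarith [hpen2 hz t, l1_nonneg (resV z t)])⟩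
  have step (t : Fin 3) (h : ∀ i, BoundedOn S fun z => z.sPrev t i) :
      (∀ i, BoundedOn S fun z => z.w t i) ∧ ∀ i, BoundedOn S fun z => z.s t i := by
    have hw (i) : BoundedOn S fun z => z.w t i := by
      have hW := boundedOn_mulVec (B := Point.W) (fun i j => hparam _) h i
      have hA := boundedOn_mulVec (B := Point.A) (fun i j => hparam _)
        (fun j => boundedOn_const (S := S) (x t j)) i
      have hb : BoundedOn S fun z => z.b i := hparam _
      have := (((hresW t i).add hW).add hA).add hb
      convert this using 2 with z
      simp only [resW, Pi.sub_apply]; ring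
    refine ⟨hw, fun i => ?_⟩
    simpa [resS] using (hresS t i).add ((hw i).sigma hα₀ hα₁)
  have h0 := step 0 fun i => boundedOn_const 0
  have h1 := step 1 h0.2
  have h2 := step 2 h1.2
  have hws (t : Fin 3) : (∀ i, BoundedOn S fun z => z.w t i) ∧
      ∀ i, BoundedOn S fun z => z.s t i := by
    fin_cases t
    exacts [h0, h1, h2]
  have hv (t i) : BoundedOn S fun z => z.v t i := by
    have hV := boundedOn_mulVec (B := Point.V) (fun i j => hparam _) (hws t).2 i
    have hc : BoundedOn S fun z => z.c i := hparam _
    convert ((hresV t i).add hV).add hc using 2 with z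
    simp only [resV, Pi.sub_apply]; ring
  have hr (t i) : BoundedOn S fun z => z.r t i := by
    simpa [resR] using (hresR t i).add ((hv t i).sigma hα₀ hα₁)
  refine isBounded_of_boundedOn_coord ?_
  rintro (i | ⟨t, i⟩ | ⟨t, i⟩ | ⟨t, i⟩ | ⟨t, i⟩)
  exacts [hparam i, (hws t).1 i, (hws t).2 i, hv t i, hr t i]

theorem isClosed_feasible (hα₀ : 0 ≤ α) (hα₁ : α < 1) :
    IsClosed (feasible x α : Set (Point N₀ N₁ N₂)) := by
  have : (feasible x α : Set (Point N₀ N₁ N₂)) = ⋂ t, {z | resW x z t = 0} ∩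
      ({z | resS α z t = 0} ∩ ({z | resV z t = 0} ∩ {z | resR α z t = 0})) := by
    ext z
    simp [mem_feasible_iff]
  rw [this]
  refine isClosed_iInter fun t => IsClosed.inter ?_ (IsClosed.inter ?_ (IsClosed.inter ?_ ?_))
  · exact isClosed_eq (continuous_pi fun i => (contDiff_resW x t i (n := 1)).continuous)
      continuous_const
  · exact isClosed_eq (continuous_pi fun i => (locallyLipschitz_resS hα₀ hα₁ t i).continuous)
      continuous_const
  · exact isClosed_eq (continuous_pi fun i => (contDiff_resV t i (n := 1)).continuous)
      continuous_const
  · exact isClosed_eq (continuous_pi fun i => (locallyLipschitz_resR hα₀ hα₁ t i).continuous)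
      continuous_const

end RNN

/-- A continuous function with a nonempty compact sublevel set relative to a closed set has a
nonempty compact set of minimizers over it. -/
theorem nonempty_isCompact_globalMinimizers {E : Type*} {f : E → ℝ}
    {S : Set E} [NormedAddCommGroup E] {x₀ : E} (hS : IsClosed S) (hf : Continuous f) (hx₀ : x₀ ∈ S)
    (hK : IsCompact {x ∈ S | f x ≤ f x₀}) :
    (globalMinimizers f S).Nonempty ∧ IsCompact (globalMinimizers f S) := by
  constructor
  · obtain ⟨m, ⟨hmS, hm⟩, hmin⟩ := hK.exists_isMinOn ⟨x₀, hx₀, le_rfl⟩ hf.continuousOn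
    refine ⟨m, hmS, fun x hx => ?_⟩
    rcases le_total (f x) (f x₀) with h | h
    · exact hmin ⟨hx, h⟩
    · exact hm.trans h
  · have hclosed : IsClosed (globalMinimizers f S) := by
      have : globalMinimizers f S = S ∩ ⋂ x ∈ S, {z | f z ≤ f x} := by
        ext z; simp [globalMinimizers]
      rw [this]
      exact hS.inter (isClosed_biInter fun x _ => isClosed_le hf continuous_const)
    exact hK.of_isClosed_subset hclosed fun z hz => ⟨hz.1, hz.2 x₀ hx₀⟩

namespace RNN

variable {N₀ N₁ N₂ : ℕ} {x : Fin 3 → Fin N₀ → ℝ} {y : Fin 3 → Fin N₂ → ℝ} {α lam β₁ β₂ : ℝ}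

theorem isCompact_level_Theta (hα₀ : 0 ≤ α) (hα₁ : α < 1) (hlam : 0 < lam) (hβ₁ : 0 < β₁)
    (hβ₂ : 0 < β₂) (G : ℝ) :
    IsCompact {z : Point N₀ N₁ N₂ | Theta x y α lam β₁ β₂ z ≤ G} :=
  Metric.isCompact_of_isClosed_isBounded
    (isClosed_le (locallyLipschitz_Theta hα₀ hα₁).continuous continuous_const)
    (isBounded_level_Theta hα₀ hα₁ hlam hβ₁ hβ₂ G)

theorem globalMinimizers_Theta (hα₀ : 0 ≤ α) (hα₁ : α < 1) (hlam : 0 < lam) (hβ₁ : 0 < β₁)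
    (hβ₂ : 0 < β₂) :
    (globalMinimizers (Theta x y α lam β₁ β₂ : Point N₀ N₁ N₂ → ℝ) Set.univ).Nonempty ∧
      IsCompact (globalMinimizers (Theta x y α lam β₁ β₂ : Point N₀ N₁ N₂ → ℝ) Set.univ) := by
  refine nonempty_isCompact_globalMinimizers (x₀ := 0) isClosed_univ
    (locallyLipschitz_Theta hα₀ hα₁).continuous (Set.mem_univ _) ?_
  simpa using isCompact_level_Theta hα₀ hα₁ hlam hβ₁ hβ₂ _

theorem globalMinimizers_F (x : Fin 3 → Fin N₀ → ℝ) (hα₀ : 0 ≤ α) (hα₁ : α < 1) (hlam : 0 < lam) :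
    (globalMinimizers (F y lam : Point N₀ N₁ N₂ → ℝ) (feasible x α)).Nonempty ∧
      IsCompact (globalMinimizers (F y lam : Point N₀ N₁ N₂ → ℝ) (feasible x α)) := by
  have hFc : Continuous (F y lam : Point N₀ N₁ N₂ → ℝ) := (contDiff_F y lam (n := 1)).continuous
  have hcl := isClosed_feasible (N₁ := N₁) (N₂ := N₂) (x := x) hα₀ hα₁
  refine nonempty_isCompact_globalMinimizers (x₀ := 0) hcl hFc (zero_mem_feasible x α) ?_
  -- `F` and the penalized objective with unit weights agree on the feasible set.
  refine (isCompact_level_Theta (x := x) (y := y) hα₀ hα₁ hlam one_pos one_pos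
    (F y lam (0 : Point N₀ N₁ N₂))).of_isClosed_subset
    (hcl.inter (isClosed_le hFc continuous_const)) ?_
  rintro z ⟨hz, hle⟩
  exact (Theta_eq_F hz).trans_le hle

theorem globalMinimizers_F_eq_Theta (hα₀ : 0 ≤ α) (hα₁ : α < 1) (hlam : 0 < lam) (hβ₁ : 0 < β₁)
    (hβ₂ : 0 < β₂) (hβ₁' : gammaOne y lam * gammaY y * √(2 / (3 * lam)) < β₁)
    (hβ₂' : √(2 * gammaY y / 3) < β₂) :
    globalMinimizers (F y lam : Point N₀ N₁ N₂ → ℝ) (feasible x α) =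
      globalMinimizers (Theta x y α lam β₁ β₂) Set.univ := by
  have hfeas {z : Point N₀ N₁ N₂} (hz : z ∈ globalMinimizers (Theta x y α lam β₁ β₂) Set.univ) :
      z ∈ feasible x α := by
    have hmin : IsLocalMin (Theta x y α lam β₁ β₂) z :=
      Eventually.of_forall fun z' => hz.2 z' (Set.mem_univ _)
    have hle : Theta x y α lam β₁ β₂ z ≤ gammaY y := (hz.2 0 (Set.mem_univ _)).trans_eq Theta_zero
    exact mem_feasible_of_forall_dTheta_nonneg hα₀ hα₁ hlam ((F_le_Theta hβ₁ hβ₂ z).trans hle)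
      hβ₁' hβ₂' ((isDStationary_Theta_iff hα₁ z).1
        (isSecondOrderDStationary_Theta_of_isLocalMin hα₁ hmin).1)
  ext z
  constructor
  · intro hz
    obtain ⟨z₁, hz₁⟩ := (globalMinimizers_Theta (N₁ := N₁) (N₂ := N₂) (x := x) (y := y)
      hα₀ hα₁ hlam hβ₁ hβ₂).1
    refine ⟨Set.mem_univ _, fun z' hz' => ?_⟩
    calc _ = F y lam z := Theta_eq_F hz.1
      _ ≤ F y lam z₁ := hz.2 z₁ (hfeas hz₁)
      _ = _ := (Theta_eq_F (hfeas hz₁)).symm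
      _ ≤ _ := hz₁.2 z' hz'
  · intro hz
    refine ⟨hfeas hz, fun z' hz' => ?_⟩
    rw [← Theta_eq_F (y := y) (lam := lam) (β₁ := β₁) (β₂ := β₂) (hfeas hz), ← Theta_eq_F hz']
    exact hz.2 z' (Set.mem_univ _)

end RNN

theorem mainTheorem7 (N₀ N₁ N₂ : ℕ) (x : Fin 3 → Fin N₀ → ℝ) (y : Fin 3 → Fin N₂ → ℝ)
    (α lam β₁ β₂ : ℝ) (hα₀ : 0 ≤ α) (hα₁ : α < 1) (hlam : 0 < lam)
    (hβ₁ : 0 < β₁) (hβ₂ : 0 < β₂)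
    (F : RNN.Point N₀ N₁ N₂ → ℝ) (hF : F = RNN.F y lam)
    (Θ : RNN.Point N₀ N₁ N₂ → ℝ) (hΘ : Θ = RNN.Theta x y α lam β₁ β₂)
    (F₀ : Set (RNN.Point N₀ N₁ N₂)) (hF₀ : F₀ = RNN.feasible x α) :
    -- the solution sets are nonempty and compact
    ((globalMinimizers F F₀).Nonempty ∧ IsCompact (globalMinimizers F F₀)) ∧
    ((globalMinimizers Θ Set.univ).Nonempty ∧ IsCompact (globalMinimizers Θ Set.univ)) ∧
    -- the regularity that the notions of stationarity presuppose
    (ContDiff ℝ 2 F ∧ LocallyLipschitz Θ ∧ ∀ z, TwiceDirDifferentiableAt Θ z) ∧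
    -- local minimizers of the constrained problem are second-order d-stationary
    (∀ z ∈ F₀, IsLocalMinOn F F₀ z → IsSecondOrderDStationary F F₀ z) ∧
    (∀ z, IsSecondOrderDStationary F F₀ z ↔
      z ∈ F₀ ∧
      (∀ d ∈ bouligandCone F₀ z, 0 ≤ inner ℝ (gradient F z) d) ∧
      (∀ d ∈ radialCone F₀ z, inner ℝ (gradient F z) d = 0 →
        0 ≤ inner ℝ d (fderiv ℝ (gradient F) z d))) ∧
    -- local minimizers of the penalized problem are second-order d-stationary
    (∀ z, IsLocalMin Θ z → IsSecondOrderDStationary Θ Set.univ z) ∧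
    (∀ z, IsSecondOrderDStationary Θ Set.univ z ↔
      (∀ d, ∃ l, HasDirDeriv Θ z d l ∧ 0 ≤ l) ∧
      (∀ d, HasDirDeriv Θ z d 0 → ∃ q, HasDirDeriv2 Θ z d q ∧ 0 ≤ q)) ∧
    -- the tangent cone and the radial cone of the feasible set
    (∀ z ∈ F₀,
      bouligandCone F₀ z =
        {d : RNN.Point N₀ N₁ N₂ | ∀ t : Fin 3,
          d.v t = d.V *ᵥ z.s t + z.V *ᵥ d.s t + d.c ∧
          (∀ i, HasDirDeriv (RNN.sigma α) (z.v t i) (d.v t i) (d.r t i)) ∧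
          d.w t = d.W *ᵥ z.sPrev t + z.W *ᵥ d.sPrev t + d.A *ᵥ x t + d.b ∧
          (∀ i, HasDirDeriv (RNN.sigma α) (z.w t i) (d.w t i) (d.s t i))} ∧
      radialCone F₀ z =
        {d : RNN.Point N₀ N₁ N₂ | d ∈ bouligandCone F₀ z ∧
          ∀ t : Fin 3, d.V *ᵥ d.s t = 0 ∧ d.W *ᵥ d.sPrev t = 0}) ∧
    -- exactness of the penalty above the explicit thresholds
    Θ 0 = RNN.gammaY y ∧
    (β₁ > RNN.gammaOne y lam * RNN.gammaY y * Real.sqrt (2 / (3 * lam)) →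
      β₂ > Real.sqrt (2 * RNN.gammaY y / 3) →
      globalMinimizers F F₀ = globalMinimizers Θ Set.univ ∧
      ∀ z, Θ z ≤ RNN.gammaY y → (IsDStationary F F₀ z ↔ IsDStationary Θ Set.univ z)) := by
  subst hF hΘ hF₀
  refine ⟨RNN.globalMinimizers_F x hα₀ hα₁ hlam,
    RNN.globalMinimizers_Theta hα₀ hα₁ hlam hβ₁ hβ₂,
    ⟨RNN.contDiff_F y lam, RNN.locallyLipschitz_Theta hα₀ hα₁,
      RNN.twiceDirDifferentiableAt_Theta hα₁⟩,
    fun z hz hmin => RNN.isSecondOrderDStationary_F_of_isLocalMinOn y lam hz hmin,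
    fun z => ?_, fun z => RNN.isSecondOrderDStationary_Theta_of_isLocalMin hα₁,
    fun z => isSecondOrderDStationary_univ_iff (RNN.twiceDirDifferentiableAt_Theta hα₁ z),
    fun z hz => ⟨?_, RNN.radialCone_feasible hα₀ hα₁ hz⟩, RNN.Theta_zero,
    fun h₁ h₂ => ⟨RNN.globalMinimizers_F_eq_Theta hα₀ hα₁ hlam hβ₁ hβ₂ h₁ h₂, fun z hz =>
      RNN.isDStationary_F_iff_Theta hα₀ hα₁ hlam ((RNN.F_le_Theta hβ₁ hβ₂ z).trans hz) h₁ h₂⟩⟩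
  · rw [RNN.isSecondOrderDStationary_F_iff, RNN.gradient_F, RNN.fderiv_gradF]
  · rw [RNN.bouligandCone_feasible hα₀ hα₁ hz]
    ext d
    simp only [RNN.mem_linCone_iff, Set.mem_ofPred_eq, RNN.hasDirDeriv_sigma_iff hα₁, funext_iff]
    exact forall_congr' fun t => by tauto
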